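/- Let $(E,e,T)$ be a conditional Riesz triple: $E$ is a Dedekind complete Riesz space, $e$ is a weak order unit, and $T$ is a strictly positive order continuous linear projection on $E$ with $Te=e$ whose range $R(T)$ is a Dedekind complete Riesz subspace. Let $E^u$ be the universal completion of $E$ with its $f$-algebra multiplication with unit $e$, let $E^s$ be the sup-completion, and for $0\le u\in E^u$ put $Tu:=\sup\{Tw: w\in E,\ 0\le w\le u\}\in E^s$. For an integer $p\ge1$ let $L^p(T)$ be the set of $u\in E^u$ with $T|u|^p\in E^u$, and put $Tu=Tu^+-Tu^-$ for $u\in L^1(T)$. For $y\in L^2(T)$ let $\operatorname{Var}_T(y):=T\big((y-Ty)^2\big)$. For $x,y\in E^u$ let $P_{x=y}$ and $P_{x\le y}$ be the band projections onto the disjoint complements of the bands generated by $|x-y|$ and by $(x-y)^+$, respectively. Let $\pi_x(n)=TP_{x=ne}e$ for $n\in\mathbb N=\{0,1,2,\dots\}$ and $F_x(t)=TP_{x\le te}e$ for $t\in\mathbb R$. The element $x$ is *natural* if $\sum_{n\ge0}\pi_x(n)=e$ (order convergence). For a natural element $x$, the generating function is $$g_x(s)=\sum_{n\ge0}s^n\pi_x(n)\in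 E^s\quad(s\ge0),$$ and the generalized generating function is $$\widetilde g_x(u)=\sum_{n\ge0}\pi_x(n)u^n\in E^s\quad(0\le u\in E^u),$$ extended to all $a\in E^s$ with $a\ge 0$ by $\widetilde g_x(a)=\sup\{\widetilde g_x(u):u\in E^u,\ 0\le u\le a\}$. A family $(f_i)_{i\in I}$ in $E^u$ is *$T$-independent* if $$TP_{i_1}P_{i_2}\cdots P_{i_k}e=TP_{i_1}TP_{i_2}\cdots TP_{i_k}e$$ for all distinct $i_1,\dots,i_k\in I$ and all band projections $P_i$ such that $P_ie$ lies in the order closed Riesz subspace generated by $f_i$ and $R(T)$. Let $N,x_1,x_2,\dots$ be natural elements of $E^u$ (for instance of $E$) such that $F_{x_n}=F_{x_1}$ for all $n$ and such that the family $(N,x_1,x_2,\dots)$ is $T$-independent. Put $x:=x_1$, $S_n:=x_1+\dots+x_n$ and $S_N:=\sum_{n\ge1}P_{N=ne}S_n$. Then this series order converges in $E^u$, its sum $S_N$ is natural, and: 1. $g_{S_N}(s)=\widetilde g_N(g_x(s))$ for all $s\ge0$. 2. If $N,x\in L^1(T)$, then $S_N\in L^1(T)$ and $TS_N=TN\cdot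 Tx$. 3. If $N,x\in L^2(T)$, then $S_N\in L^2(T)$ and $$\operatorname{Var}_T(S_N)=TN\cdot\operatorname{Var}_T(x)+\operatorname{Var}_T(N)\cdot(Tx)^2.$$ Moreover $\operatorname{Var}_T(y)=T(y^2)-(Ty)^2$ for every $y\in L^2(T)$. -/

import Mathlib

/-!
# Conditional Riesz triples, natural elements and generating functions

Throughout, `E` is a Dedekind complete Riesz space (a conditionally complete lattice which is an
ordered real vector space), and `ι : E → U` is its universal completion, where `U` carries its
`f`-algebra multiplication with unit `ι e = 1`.  All elements of `U` may be unbounded.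
-/

namespace RieszGF

/-! ### Conditional Riesz triples -/

section Triple

variable {E : Type*} [ConditionallyCompleteLattice E] [AddCommGroup E] [Module ℝ E]

/-- `(E, e, T)` is a conditional Riesz triple: `e` is a weak order unit of the Dedekind complete
Riesz space `E`, and `T` is a strictly positive order continuous projection with `T e = e` whose
range is a Dedekind complete Riesz subspace. -/
structure IsConditionalRieszTriple (e : E) (T : E →ₗ[ℝ] E) : Prop where
  unit_nonneg : 0 ≤ e
  weak_unit : ∀ x : E, 0 ≤ x → x ⊓ e = 0 → x = 0
  nonneg : ∀ x : E, 0 ≤ x → 0 ≤ T x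
  strictly_pos : ∀ x : E, 0 < x → 0 < T x
  /-- Order continuity; for a positive operator this is preservation of the suprema of upward
  directed sets. -/
  order_cont : ∀ D : Set E, D.Nonempty → DirectedOn (· ≤ ·) D →
    ∀ a : E, IsLUB D a → IsLUB (T '' D) (T a)
  idem : ∀ x : E, T (T x) = T x
  map_unit : T e = e
  range_sup : ∀ x y : E, T x ⊔ T y ∈ Set.range T
  range_complete : ∀ S : Set E, S ⊆ Set.range T → S.Nonempty →
    (∃ b ∈ Set.range T, b ∈ upperBounds S) →
    ∃ a ∈ Set.range T, a ∈ upperBounds S ∧ ∀ b ∈ Set.range T, b ∈ upperBounds S → a ≤ b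

end Triple

/-! ### The universal completion -/

section Completion

variable {E : Type*} [ConditionallyCompleteLattice E] [AddCommGroup E] [Module ℝ E]
variable {U : Type*} [ConditionallyCompleteLattice U] [CommRing U] [Algebra ℝ U]

/-- `ι : E → U` is the universal completion of the Riesz space `E` with weak order unit `e`:
`U` is a universally complete Riesz space (Dedekind complete and laterally complete), `ι` embeds
`E` as an order dense Riesz subspace, and `U` carries its `f`-algebra multiplication with
multiplicative unit `e`.  These properties determine `(U, ι)` up to a unique isomorphism of
lattice ordered algebras under `E`. -/
structure IsUniversalCompletion (e : E) (ι : E →ₗ[ℝ] U) : Prop where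
  injective : Function.Injective ι
  map_sup : ∀ x y : E, ι (x ⊔ y) = ι x ⊔ ι y
  order_dense : ∀ u : U, 0 < u → ∃ x : E, 0 < x ∧ ι x ≤ u
  /-- Lateral completeness: sets of pairwise disjoint positive elements have a supremum. -/
  laterally_complete : ∀ S : Set U, (∀ x ∈ S, 0 ≤ x) →
    (∀ x ∈ S, ∀ y ∈ S, x ≠ y → x ⊓ y = 0) → BddAbove S
  /-- The `f`-algebra property. -/
  mul_disjoint : ∀ a b c : U, a ⊓ b = 0 → 0 ≤ c → (c * a) ⊓ b = 0
  map_unit : ι e = 1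

end Completion

/-! ### Band projections in `U` -/

section Band

variable {U : Type*} [ConditionallyCompleteLattice U] [CommRing U] [Algebra ℝ U]

/-- Band projections: the idempotent linear maps `P` with `0 ≤ P ≤ I`. -/
structure IsBandProjection (P : U →ₗ[ℝ] U) : Prop where
  idem : ∀ x : U, P (P x) = P x
  nonneg : ∀ x : U, 0 ≤ x → 0 ≤ P x
  le_self : ∀ x : U, 0 ≤ x → P x ≤ x

/-- The band projection `P_u` onto the band generated by `u`: for `y ≥ 0` it is
`sup_n (y ⊓ n|u|)`, and in general `P_u y = P_u y⁺ - P_u y⁻`. -/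
noncomputable def bandProj (u y : U) : U :=
  (⨆ n : ℕ, y⁺ ⊓ n • |u|) - ⨆ n : ℕ, y⁻ ⊓ n • |u|

/-- The projection `P_{x = y} = P_{|x - y|}ᵈ`, applied to `z`. -/
noncomputable def projEq (x y z : U) : U := z - bandProj |x - y| z

/-- The projection `P_{x ≤ y} = P_{(x - y)⁺}ᵈ`, applied to `z`. -/
noncomputable def projLe (x y z : U) : U := z - bandProj (x - y)⁺ z

/-- Order closed Riesz subspaces of `U`. -/
structure IsClosedRieszSubspace (F : Submodule ℝ U) : Prop where
  sup_mem : ∀ x ∈ F, ∀ y ∈ F, x ⊔ y ∈ F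
  closed : ∀ D : Set U, D ⊆ F → D.Nonempty → ∀ a : U, IsLUB D a → a ∈ F

/-- The closed Riesz subspace generated by a set. -/
def closedRieszSpan (A : Set U) : Set U :=
  {y | ∀ F : Submodule ℝ U, IsClosedRieszSubspace F → A ⊆ F → y ∈ F}

end Band

/-! ### The positive cone of the sup-completion -/

section SupCone

variable {U : Type*} [ConditionallyCompleteLattice U] [CommRing U]

/-- The positive cone of the sup-completion (possibly infinite positive elements).
An element `a` is represented by the set `{v ∈ U₊ : v ≤ a}` of finite elements below it; the sets
that occur are the lower subsets of `U₊` that are closed under existing suprema.  The order is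
inclusion. -/
def SupCone (U : Type*) [ConditionallyCompleteLattice U] [CommRing U] : Type _ :=
  {A : Set U // (0 : U) ∈ A ∧ (∀ v ∈ A, 0 ≤ v) ∧ (∀ v ∈ A, ∀ w : U, 0 ≤ w → w ≤ v → w ∈ A) ∧
    ∀ D : Set U, D ⊆ A → D.Nonempty → ∀ a : U, IsLUB D a → a ∈ A}

instance : PartialOrder (SupCone U) := inferInstanceAs (PartialOrder (Subtype _))

instance : InfSet (SupCone U) where
  sInf S := ⟨{v | 0 ≤ v ∧ ∀ A ∈ S, v ∈ A.1}, by
    refine ⟨⟨le_rfl, fun A _ => A.2.1⟩, fun v hv => hv.1, ?_, ?_⟩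
    · exact fun v hv w hw hwv => ⟨hw, fun A hA => A.2.2.2.1 v (hv.2 A hA) w hw hwv⟩
    · intro D hD hne a ha
      refine ⟨?_, fun A hA => A.2.2.2.2 D (fun v hv => (hD hv).2 A hA) hne a ha⟩
      obtain ⟨v, hv⟩ := hne
      exact (hD hv).1.trans (ha.1 hv)⟩

noncomputable instance : CompleteLattice (SupCone U) :=
  completeLatticeOfInf _ fun S =>
    ⟨fun A hA v (hv : 0 ≤ v ∧ ∀ A ∈ S, v ∈ A.1) => hv.2 A hA,
      fun B hB v hv => show 0 ≤ v ∧ ∀ A ∈ S, v ∈ A.1 from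
        ⟨B.2.2.1 v hv, fun _ hA => hB hA hv⟩⟩

/-- The inclusion of `U₊` into the cone, extended to `U` by `u ↦ u⁺`. -/
def SupCone.of (u : U) : SupCone U :=
  ⟨{v | 0 ≤ v ∧ v ≤ u ⊔ 0}, ⟨le_rfl, le_sup_right⟩, fun _ hv => hv.1,
    fun _ hv _ hw hwv => ⟨hw, hwv.trans hv.2⟩, fun D hD hne a ha => by
      obtain ⟨v, hv⟩ := hne
      exact ⟨(hD hv).1.trans (ha.1 hv), ha.2 fun w hw => (hD hw).2⟩⟩

end SupCone

/-! ### The extended conditional expectation, natural elements, generating functions -/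

section Main

variable {E : Type*} [ConditionallyCompleteLattice E] [AddCommGroup E] [Module ℝ E]
variable {U : Type*} [ConditionallyCompleteLattice U] [CommRing U] [Algebra ℝ U]
variable (T : E →ₗ[ℝ] E) (ι : E →ₗ[ℝ] U)

/-- The values of `T` at the elements of `E` between `0` and `u`. -/
def lowerValues (u : U) : Set U := {z | ∃ w : E, 0 ≤ w ∧ ι w ≤ u ∧ z = ι (T w)}

/-- `u ∈ L¹(T)`: the extension of `T` takes a value in the universal completion at `|u|`. -/
def InL1 (u : U) : Prop := BddAbove (lowerValues T ι |u|)

/-- `u ∈ Lᵖ(T)`. -/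
def InLp (p : ℕ) (u : U) : Prop := InL1 T ι (|u| ^ p)

/-- The maximal extension of `T`, with domain `L¹(T) ⊆ U`: for `u ≥ 0` its value is
`sup {T w : w ∈ E, 0 ≤ w ≤ u}`, and `T u = T u⁺ - T u⁻` in general.
Only meaningful for `u ∈ L¹(T)`. -/
noncomputable def condExp (u : U) : U :=
  sSup (lowerValues T ι u⁺) - sSup (lowerValues T ι u⁻)

/-- The mass function `π_x(n) = T P_{x = ne} e`. -/
noncomputable def mass (x : U) (n : ℕ) : U := condExp T ι (projEq x (n : U) 1)

/-- The distribution function `F_x(t) = T P_{x ≤ te} e`. -/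
noncomputable def distFun (x : U) (t : ℝ) : U :=
  condExp T ι (projLe x (algebraMap ℝ U t) 1)

/-- `x` is natural: `∑_{n ≥ 0} π_x(n) = e`. The partial sums increase, so the order limit is
their supremum. -/
def IsNatural (x : U) : Prop :=
  IsLUB (Set.range fun m : ℕ => ∑ n ∈ Finset.range m, mass T ι x n) 1

/-- The generating function `g_x(s) = ∑_{n ≥ 0} sⁿ π_x(n)`, for `s ≥ 0`, with values in the
sup-completion. -/
noncomputable def genFun (x : U) (s : ℝ) : SupCone U :=
  ⨆ m : ℕ, SupCone.of (∑ n ∈ Finset.range m, s ^ n • mass T ι x n)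

/-- The generalized generating function `g̃_x(u) = ∑_{n ≥ 0} π_x(n) uⁿ`, for `0 ≤ u ∈ U`. -/
noncomputable def genGenFun (x u : U) : SupCone U :=
  ⨆ m : ℕ, SupCone.of (∑ n ∈ Finset.range m, mass T ι x n * u ^ n)

/-- The extension of `g̃_x` to possibly infinite arguments `a`, as the supremum of the values at
the finite elements `0 ≤ u ≤ a`. -/
noncomputable def genGenFunExt (x : U) (a : SupCone U) : SupCone U :=
  ⨆ u ∈ a.1, genGenFun T ι x u

/-- `T`-independence of a family of elements: for all band projections `P i` such that `P i e`
lies in the closed Riesz subspace generated by `f i` and `R(T)`, and all distinct indices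
`i₁, …, i_k`, one has `T P_{i₁} P_{i₂} ⋯ P_{i_k} e = T P_{i₁} T P_{i₂} ⋯ T P_{i_k} e`. -/
def IsTIndependent {I : Type*} (f : I → U) : Prop :=
  ∀ P : I → U →ₗ[ℝ] U, (∀ i, IsBandProjection (P i)) →
    (∀ i, P i 1 ∈ closedRieszSpan (insert (f i) (ι '' Set.range T))) →
    ∀ l : List I, l.Nodup →
      condExp T ι (l.foldr (fun i z => P i z) 1) = l.foldr (fun i z => condExp T ι (P i z)) 1

/-- `x` and `y` have the same `T`-distribution. -/
def SameTDist (x y : U) : Prop := ∀ t : ℝ, distFun T ι x t = distFun T ι y t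

/-- The conditional variance `Var_T(y) = T (y - T y)²`. -/
noncomputable def condVar (y : U) : U := condExp T ι ((y - condExp T ι y) ^ 2)

end Main

section RandomSum

variable {U : Type*} [ConditionallyCompleteLattice U] [CommRing U] [Algebra ℝ U]

/-- The partial sums `∑_{n = 1}^m P_{N = ne} S_n` of the random sum, where
`S_n = x 0 + ⋯ + x (n - 1)`. -/
noncomputable def randomSumPartial (N : U) (x : ℕ → U) (m : ℕ) : U :=
  ∑ n ∈ Finset.Icc 1 m, projEq N (n : U) (∑ i ∈ Finset.range n, x i)

/-- The random sum `S_N = ∑_{n ≥ 1} P_{N = ne} S_n`; for natural elements the terms are positive,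
so the order limit is the supremum of the partial sums. -/
noncomputable def randomSum (N : U) (x : ℕ → U) : U := ⨆ m : ℕ, randomSumPartial N x m

end RandomSum

end RieszGF

/-! Everything happens locally. In the `f`-algebra `U` a band projection is multiplication by an
idempotent component of 1. Naturality of `y` only says that the expectations of the components
`P_{y=k}e` sum to 1; strict positivity of `T` upgrades this to a partition of 1 by the components
themselves (`IsNatural.isPartition`). On the component of `N = n, x₀ = k₀, …, xₙ₋₁ = kₙ₋₁` the
random sum is the constant `k₀ + ⋯ + kₙ₋₁`, so relations between functions of `S_N` and of the
summands reduce to real arithmetic (`mul_randomSum_eq`, `le_of_local_randomSum`).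

Expectations are treated through the relation `HasExp`, for positive elements with a finite
expectation. Monotone convergence (`hasExp_iff_of_monotone`) reduces them to elements of `E` and to
finite sums. Independence only speaks of components and nested applications of `T`. The nesting
collapses to a product of masses because values of `T` can be taken out of expectations. This
averaging property is not an axiom: a positive element of the range is squeezed between step
functions whose components are fixed by `T` (`exists_averages_approx`). Expanding products of series
then gives the product rule for functions of the variables (`IsTIndependent.hasExp_prod`).

With `a = T x₀` and `b = T x₀²`, the expectations of `S_N` and `S_N²` on `N = n` are `n π_N(n) a`
and `π_N(n) (n b + (n² - n) a²)`; summing over `n` gives mean and variance. Since `s ^ S_N` may have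
infinite expectation, the generating function is computed from two finite truncations of it that
have the same supremum (`truncSumPow_le`, `isLUB_truncPow_inf`). -/

namespace RieszGF

set_option linter.unusedSectionVars false

/-! ### Order continuity, components and band projections in a Dedekind complete `f`-algebra -/

section FAlgebra

open Set

variable {U : Type*} [ConditionallyCompleteLattice U] [CommRing U] [IsOrderedRing U]

/-- The `f`-algebra property of a lattice ordered ring. -/
def IsFAlgebra (U : Type*) [ConditionallyCompleteLattice U] [CommRing U] : Prop :=
  ∀ a b c : U, a ⊓ b = 0 → 0 ≤ c → (c * a) ⊓ b = 0

/-- A Dedekind complete ordered group is Archimedean. -/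
theorem nonpos_of_nsmul_le {G : Type*} [ConditionallyCompleteLattice G] [AddCommGroup G]
    [IsOrderedAddMonoid G] {x y : G} (h : ∀ n : ℕ, n • x ≤ y) : x ≤ 0 := by
  have hb : BddAbove (range fun n : ℕ => n • x) := ⟨y, by rintro _ ⟨n, rfl⟩; exact h n⟩
  have hl := isLUB_ciSup hb
  have : (⨆ n : ℕ, n • x) ≤ (⨆ n : ℕ, n • x) - x := hl.2 (by
    rintro _ ⟨n, rfl⟩
    have := hl.1 ⟨n + 1, rfl⟩
    simp only [succ_nsmul] at this
    exact le_sub_iff_add_le.2 this)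
  simpa using this

/-- The identity `u ⊓ a + u ⊔ a = u + a` turns an upper bound `w` of the infima into the upper bound
`w + (u ⊔ A) - u` of the family itself. -/
theorem isLUB_inf_range {G κ : Type*} [Lattice G] [AddCommGroup G]
    [IsOrderedAddMonoid G] {a : κ → G} {A : G} (h : IsLUB (range a) A) (u : G) :
    IsLUB (range fun k => u ⊓ a k) (u ⊓ A) := by
  constructor
  · rintro _ ⟨k, rfl⟩
    exact inf_le_inf_left _ (h.1 ⟨k, rfl⟩)
  · intro w hw
    have h1 : A ≤ w + (u ⊔ A) - u := h.2 (by
      rintro _ ⟨k, rfl⟩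
      have h2 := hw ⟨k, rfl⟩
      have h3 := inf_add_sup u (a k)
      have h4 : u ⊔ a k ≤ u ⊔ A := sup_le_sup_left (h.1 ⟨k, rfl⟩) _
      have h5 := add_le_add h2 h4
      simp only at h5
      rw [h3] at h5
      exact le_sub_iff_add_le.2 (by rwa [add_comm]))
    have h6 := le_sub_iff_add_le.1 h1
    rw [add_comm, ← inf_add_sup u A] at h6
    exact le_of_add_le_add_right h6

theorem isLUB_add_range {G : Type*} [Lattice G] [AddCommGroup G]
    [IsOrderedAddMonoid G] {a b : ℕ → G} {A B : G} (ha : IsLUB (range a) A)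
    (hb : IsLUB (range b) B) (ma : Monotone a) (mb : Monotone b) :
    IsLUB (range fun k => a k + b k) (A + B) := by
  constructor
  · rintro _ ⟨k, rfl⟩
    exact add_le_add (ha.1 ⟨k, rfl⟩) (hb.1 ⟨k, rfl⟩)
  · intro w hw
    have h1 : A ≤ w - B := ha.2 (by
      rintro _ ⟨i, rfl⟩
      have : B ≤ w - a i := hb.2 (by
        rintro _ ⟨j, rfl⟩
        have h2 := hw ⟨max i j, rfl⟩
        have h3 := add_le_add (ma (le_max_left i j)) (mb (le_max_right i j))
        exact le_sub_iff_add_le'.2 (h3.trans h2))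
      exact le_sub_comm.1 this)
    exact le_sub_iff_add_le.1 h1

theorem isLUB_range_of_cofinal {G : Type*} [PartialOrder G] {a b : ℕ → G} {A : G}
    (h : IsLUB (range a) A) (h1 : ∀ n, ∃ m, a n ≤ b m) (h2 : ∀ n, b n ≤ A) :
    IsLUB (range b) A := by
  refine ⟨by rintro _ ⟨n, rfl⟩; exact h2 n, fun w hw => h.2 ?_⟩
  rintro _ ⟨n, rfl⟩
  obtain ⟨m, hm⟩ := h1 n
  exact hm.trans (hw ⟨m, rfl⟩)

namespace IsFAlgebra

/-- Subtracting `a ⊓ b` makes the two elements disjoint, and the `f`-algebra property, used once on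
each side, keeps them disjoint after multiplication by `c`. -/
theorem mul_inf (hU : IsFAlgebra U) {c : U} (hc : 0 ≤ c) (a b : U) :
    c * (a ⊓ b) = c * a ⊓ c * b := by
  have h0 : (a - a ⊓ b) ⊓ (b - a ⊓ b) = 0 := by
    rw [sub_eq_add_neg, sub_eq_add_neg, ← inf_add, add_neg_cancel]
  have h1 := hU _ _ c h0 hc
  rw [inf_comm] at h1
  have h2 := hU _ _ c h1 hc
  have h3 : c * a ⊓ c * b = (c * (b - a ⊓ b)) ⊓ (c * (a - a ⊓ b)) + c * (a ⊓ b) := by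
    rw [inf_add, inf_comm]
    congr 1 <;> ring
  rw [h3, h2, zero_add]

theorem mul_sup (hU : IsFAlgebra U) {c : U} (hc : 0 ≤ c) (a b : U) :
    c * (a ⊔ b) = c * a ⊔ c * b := by
  have h := hU.mul_inf hc (-a) (-b)
  rw [← neg_sup, mul_neg, mul_neg, mul_neg, ← neg_sup] at h
  exact neg_injective h

theorem mul_posPart (hU : IsFAlgebra U) {c : U} (hc : 0 ≤ c) (a : U) :
    c * a⁺ = (c * a)⁺ := by
  rw [posPart_def, hU.mul_sup hc, mul_zero, posPart_def]

theorem mul_abs (hU : IsFAlgebra U) {c : U} (hc : 0 ≤ c) (a : U) :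
    c * |a| = |c * a| := by
  rw [abs, hU.mul_sup hc, mul_neg, abs]

theorem mul_eq_zero_of_inf (hU : IsFAlgebra U) {a b : U} (h : a ⊓ b = 0) : a * b = 0 := by
  have ha : 0 ≤ a := h ▸ inf_le_left
  have hb : 0 ≤ b := h ▸ inf_le_right
  have h1 := hU _ _ b h hb
  rw [inf_comm] at h1
  have h2 := hU _ _ a h1 ha
  rwa [mul_comm b a, inf_idem] at h2

theorem posPart_mul_negPart (hU : IsFAlgebra U) (a : U) : a⁺ * a⁻ = 0 :=
  hU.mul_eq_zero_of_inf (posPart_inf_negPart_eq_zero a)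

theorem mul_self_nonneg (hU : IsFAlgebra U) (a : U) : 0 ≤ a * a := by
  have h : a * a = a⁺ * a⁺ + a⁻ * a⁻ := by
    conv_lhs => rw [← posPart_sub_negPart a]
    linear_combination (-2) * hU.posPart_mul_negPart a
  rw [h]
  exact add_nonneg (mul_nonneg (posPart_nonneg a) (posPart_nonneg a))
    (mul_nonneg (negPart_nonneg a) (negPart_nonneg a))

/-- The square `(1 - n a)² = 1 - 2 n a` is positive for every `n`, so the Archimedean property
applies. -/
theorem eq_zero_of_mul_self (hU : IsFAlgebra U) {a : U} (h : a * a = 0) (ha : 0 ≤ a) :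
    a = 0 := by
  refine le_antisymm (nonpos_of_nsmul_le (y := 1) fun n => ?_) ha
  have h1 := hU.mul_self_nonneg (1 - n * a)
  have h2 : (1 - n * a) * (1 - n * a) = 1 - n * a - n * a := by
    linear_combination (n : U) ^ 2 * h
  rw [h2] at h1
  have h3 : 0 ≤ (n : U) * a := mul_nonneg (Nat.cast_nonneg n) ha
  rw [nsmul_eq_mul]
  have h4 := le_sub_iff_add_le.1 h1
  have h5 := le_sub_iff_add_le.1 h4
  calc (n : U) * a ≤ 0 + n * a + n * a := by rw [zero_add]; exact le_add_of_nonneg_right h3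
    _ ≤ 1 := h5

theorem inf_eq_zero_of_mul (hU : IsFAlgebra U) {a b : U} (ha : 0 ≤ a) (hb : 0 ≤ b)
    (h : a * b = 0) : a ⊓ b = 0 := by
  have h0 : 0 ≤ a ⊓ b := le_inf ha hb
  refine hU.eq_zero_of_mul_self (le_antisymm ?_ (mul_nonneg h0 h0)) h0
  rw [← h]
  exact mul_le_mul inf_le_left inf_le_right h0 ha

/-- Multiplication by a positive element preserves suprema. -/
theorem isLUB_mul [Algebra ℝ U] [IsOrderedModule ℝ U] (hU : IsFAlgebra U) {κ : Type*} {a : κ → U} {A c : U}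
    (h : IsLUB (range a) A) (hc : 0 ≤ c) : IsLUB (range fun k => c * a k) (c * A) := by
  constructor
  · rintro _ ⟨k, rfl⟩
    exact mul_le_mul_of_nonneg_left (h.1 ⟨k, rfl⟩) hc
  · intro w hw
    -- The excess `v = (c A - w)⁺` lies below every `c (A - a k)`. As `c` may be unbounded, it is
    -- cut off by `d = (n - c)⁺`, for which `d c ≤ n²`; then `d v ≤ n² (A - a k)` for all `k` forces
    -- `d v = 0`.
    have hv0 : 0 ≤ (c * A - w)⁺ := posPart_nonneg _
    have hv : ∀ k, (c * A - w)⁺ ≤ c * (A - a k) := fun k => by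
      rw [posPart_def]
      refine sup_le ?_ (mul_nonneg hc (sub_nonneg.2 (h.1 ⟨k, rfl⟩)))
      rw [mul_sub]
      exact sub_le_sub_left (hw ⟨k, rfl⟩) _
    set v := (c * A - w)⁺
    have key : ∀ n : ℕ, ((n : U) - c)⁺ * v = 0 := fun n => by
      set d := ((n : U) - c)⁺ with hd
      have hd0 : 0 ≤ d := posPart_nonneg _
      have hdn : d ≤ n := by
        rw [hd, posPart_def]
        exact sup_le (sub_le_self _ hc) (Nat.cast_nonneg n)
      have hn0 : (0 : U) ≤ n := Nat.cast_nonneg n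
      have hdc : d * c ≤ n * n := by
        have h1 : d * ((n : U) - c)⁻ = 0 := hU.posPart_mul_negPart _
        have h2 : d - ((n : U) - c)⁻ = n - c := posPart_sub_negPart _
        have h3 : d * c = d * n - d * d := by linear_combination h1 + d * h2
        rw [h3]
        exact (sub_le_self _ (hU.mul_self_nonneg d)).trans (mul_le_mul_of_nonneg_right hdn hn0)
      have h4 : ∀ k, d * v ≤ (n * n : ℕ) • (A - a k) := fun k => by
        rw [nsmul_eq_mul, Nat.cast_mul]
        calc d * v ≤ d * (c * (A - a k)) := mul_le_mul_of_nonneg_left (hv k) hd0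
          _ = d * c * (A - a k) := by ring
          _ ≤ n * n * (A - a k) :=
            mul_le_mul_of_nonneg_right hdc (sub_nonneg.2 (h.1 ⟨k, rfl⟩))
      rcases Nat.eq_zero_or_pos n with rfl | hn
      · have : d = 0 := le_antisymm (by simpa using hdn) hd0
        rw [this, zero_mul]
      · refine le_antisymm ?_ (mul_nonneg hd0 hv0)
        have hr : (0 : ℝ) < (n * n : ℕ) := by positivity
        have hb : A ≤ A - ((n * n : ℕ) : ℝ)⁻¹ • (d * v) := h.2 (by
          rintro _ ⟨k, rfl⟩
          have h5 := h4 k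
          rw [← Nat.cast_smul_eq_nsmul ℝ] at h5
          exact le_sub_comm.1 ((inv_smul_le_iff_of_pos hr).2 h5))
        have h6 : ((n * n : ℕ) : ℝ)⁻¹ • (d * v) ≤ 0 := by simpa using hb
        simpa using (inv_smul_le_iff_of_pos hr).1 h6
    -- From `(n - c)⁺ v = 0` comes `n v ≤ c v` for every `n`, hence `v ≤ 0`.
    refine sub_nonpos.1 ((le_posPart _).trans (nonpos_of_nsmul_le (y := c * v) fun n => ?_))
    rw [nsmul_eq_mul]
    have h1 : ((n : U) - c) * v ≤ ((n : U) - c)⁺ * v :=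
      mul_le_mul_of_nonneg_right (le_posPart _) hv0
    rw [key n, sub_mul] at h1
    exact sub_nonpos.1 h1

variable [Algebra ℝ U] [IsOrderedModule ℝ U]

/-- Inequalities may be checked on the members of a family of components. -/
theorem mul_le_mul_of_local (hU : IsFAlgebra U) {κ : Type*} [Nonempty κ] {c : κ → U} {d u v : U}
    (h : IsLUB (range c) d) (hc : ∀ k, 0 ≤ c k) (huv : ∀ k, c k * u ≤ c k * v) :
    d * u ≤ d * v := by
  have h0 : ∀ k, (u - v)⁺ * c k = 0 := fun k => by
    rw [mul_comm, hU.mul_posPart (hc k), mul_sub, posPart_eq_zero]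
    exact sub_nonpos.2 (huv k)
  have h1 := hU.isLUB_mul h (posPart_nonneg (u - v))
  simp only [h0, range_const] at h1
  have h2 : (u - v)⁺ * d = 0 := h1.unique isLUB_singleton
  have hd : 0 ≤ d := (hc (Classical.arbitrary κ)).trans (h.1 ⟨_, rfl⟩)
  have h3 := mul_le_mul_of_nonneg_left (le_posPart (u - v)) hd
  rw [mul_comm d (u - v)⁺, h2, mul_sub] at h3
  exact sub_nonpos.1 h3

theorem idem_nonneg (hU : IsFAlgebra U) {p : U} (hp : IsIdempotentElem p) : 0 ≤ p := by
  rw [← hp.eq]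
  exact hU.mul_self_nonneg p

theorem idem_le_one (hU : IsFAlgebra U) {p : U} (hp : IsIdempotentElem p) : p ≤ 1 :=
  sub_nonneg.1 (hU.idem_nonneg hp.one_sub)

theorem isLUB_bandProj_one (u : U) :
    IsLUB (range fun n : ℕ => 1 ⊓ n • |u|) (bandProj u 1) := by
  have h1 : (1 : U)⁺ = 1 := posPart_of_nonneg zero_le_one
  have h2 : (1 : U)⁻ = 0 := negPart_of_nonneg zero_le_one
  have h3 : ∀ n : ℕ, (0 : U) ⊓ n • |u| = 0 := fun n =>
    inf_eq_left.2 (nsmul_nonneg (abs_nonneg u) n)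
  simp only [bandProj, h1, h2, h3, ciSup_const, sub_zero]
  exact isLUB_ciSup ⟨1, by rintro _ ⟨n, rfl⟩; exact inf_le_left⟩

theorem bandProj_one_le (u : U) : bandProj u 1 ≤ 1 :=
  (isLUB_bandProj_one u).2 (by rintro _ ⟨n, rfl⟩; exact inf_le_left)

theorem bandProj_one_nonneg (u : U) : 0 ≤ bandProj u 1 :=
  (isLUB_bandProj_one u).1 ⟨0, by simp⟩

/-- Doubling the supremum `b` of `1 ⊓ n|u|` and truncating at 1 gives nothing new, so `1 ⊓ 2b ≤ b`.
This says that `b` and `1 - b` are disjoint, and disjoint elements have product 0. -/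
theorem bandProj_one_idem (hU : IsFAlgebra U) (u : U) : IsIdempotentElem (bandProj u 1) := by
  have hb := isLUB_bandProj_one u
  set b := bandProj u 1
  have h1 : 1 ⊓ (2 : U) * b ≤ b := by
    have h2 := isLUB_inf_range (hU.isLUB_mul hb (c := 2) zero_le_two) 1
    refine h2.2 ?_
    rintro _ ⟨n, rfl⟩
    refine le_trans ?_ (hb.1 ⟨2 * n, rfl⟩)
    refine inf_le_inf_left 1 ?_
    rw [hU.mul_inf zero_le_two]
    refine inf_le_right.trans (le_of_eq ?_)
    rw [nsmul_eq_mul, nsmul_eq_mul]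
    push_cast
    ring
  have h3 : (1 - b) ⊓ b = 0 := by
    refine le_antisymm ?_ (le_inf (sub_nonneg.2 (bandProj_one_le u)) (bandProj_one_nonneg u))
    have h4 : (1 - b) ⊓ b = 1 ⊓ (2 : U) * b - b := by
      rw [sub_eq_add_neg (1 ⊓ _) b, inf_add]
      congr 1 <;> ring
    rw [h4]
    exact sub_nonpos.2 h1
  have h5 := hU.mul_eq_zero_of_inf h3
  rw [sub_mul, one_mul, sub_eq_zero] at h5
  exact h5.symm

theorem abs_mul_one_sub_bandProj (hU : IsFAlgebra U) (u : U) :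
    |u| * (1 - bandProj u 1) = 0 := by
  have hb := isLUB_bandProj_one u
  have hb1 := bandProj_one_le u
  set b := bandProj u 1
  refine hU.mul_eq_zero_of_inf (le_antisymm ?_ (le_inf (abs_nonneg u) (sub_nonneg.2 hb1)))
  -- Adding `|u| ⊓ (1 - b)` to the term with index `n` stays below the term with index `n + 1` and
  -- below 1, so the supremum absorbs it. The same absorption recurs below.
  have h1 : b ≤ b - |u| ⊓ (1 - b) := hb.2 (by
    rintro _ ⟨n, rfl⟩
    refine le_sub_iff_add_le.2 (le_trans (le_inf ?_ ?_) (hb.1 ⟨n + 1, rfl⟩))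
    · calc 1 ⊓ n • |u| + |u| ⊓ (1 - b) ≤ b + (1 - b) := add_le_add (hb.1 ⟨n, rfl⟩) inf_le_right
        _ = 1 := by ring
    · rw [succ_nsmul]
      exact add_le_add inf_le_right inf_le_left)
  simpa using h1

theorem mul_bandProj_eq_zero (hU : IsFAlgebra U) {c u : U} (hc : 0 ≤ c) (h : c * |u| = 0) :
    c * bandProj u 1 = 0 := by
  have h1 := hU.isLUB_mul (isLUB_bandProj_one u) hc
  have h2 : ∀ n : ℕ, c * (1 ⊓ n • |u|) = 0 := fun n => by
    rw [hU.mul_inf hc, mul_smul_comm, h, mul_one, smul_zero, inf_eq_right.2 hc]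
  simp only [h2, range_const] at h1
  exact h1.unique isLUB_singleton

theorem mul_bandProj_eq_self (hU : IsFAlgebra U) {c u : U} {ε : ℝ} (hε : 0 < ε)
    (hc : 0 ≤ c) (h : ε • c ≤ c * |u|) : c * bandProj u 1 = c := by
  have h0 : 0 ≤ 1 - bandProj u 1 := sub_nonneg.2 (bandProj_one_le u)
  have h1 := mul_le_mul_of_nonneg_right h h0
  rw [mul_assoc, hU.abs_mul_one_sub_bandProj, mul_zero, smul_mul_assoc] at h1
  have h2 : c * (1 - bandProj u 1) ≤ 0 := by
    have := smul_le_smul_of_nonneg_left h1 (inv_nonneg.2 hε.le)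
    rwa [inv_smul_smul₀ hε.ne', smul_zero] at this
  have h3 := le_antisymm h2 (mul_nonneg hc h0)
  rw [mul_sub, mul_one, sub_eq_zero] at h3
  exact h3.symm

/-- Links the lattice definition of a band projection to multiplication by a component `b`: the
supremum `s` is killed by `1 - b`, and `z - s` is disjoint from `|u|`, hence killed by `b`. -/
theorem iSup_inf_nsmul (hU : IsFAlgebra U) (u : U) {z : U} (hz : 0 ≤ z) :
    ⨆ n : ℕ, z ⊓ n • |u| = bandProj u 1 * z := by
  have hs : IsLUB (range fun n : ℕ => z ⊓ n • |u|) (⨆ n : ℕ, z ⊓ n • |u|) :=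
    isLUB_ciSup ⟨z, by rintro _ ⟨n, rfl⟩; exact inf_le_left⟩
  set s := ⨆ n : ℕ, z ⊓ n • |u|
  have hb1 : 0 ≤ 1 - bandProj u 1 := sub_nonneg.2 (bandProj_one_le u)
  have hab := hU.abs_mul_one_sub_bandProj u
  set b := bandProj u 1
  have hsz : s ≤ z := hs.2 (by rintro _ ⟨n, rfl⟩; exact inf_le_left)
  have h1 : (z - s) * |u| = 0 := by
    refine hU.mul_eq_zero_of_inf (le_antisymm ?_ (le_inf (sub_nonneg.2 hsz) (abs_nonneg u)))
    have h1 : s ≤ s - (z - s) ⊓ |u| := hs.2 (by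
      rintro _ ⟨n, rfl⟩
      refine le_sub_iff_add_le.2 (le_trans (le_inf ?_ ?_) (hs.1 ⟨n + 1, rfl⟩))
      · calc z ⊓ n • |u| + (z - s) ⊓ |u| ≤ s + (z - s) := add_le_add (hs.1 ⟨n, rfl⟩) inf_le_left
          _ = z := by ring
      · rw [succ_nsmul]
        exact add_le_add inf_le_right inf_le_right)
    simpa using h1
  have h2 : (z - s) * b = 0 := hU.mul_bandProj_eq_zero (sub_nonneg.2 hsz) h1
  have h3 : s * (1 - b) = 0 := by
    rw [mul_comm]
    have h4 := hU.isLUB_mul hs hb1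
    have h5 : ∀ n : ℕ, (1 - b) * (z ⊓ n • |u|) = 0 := fun n => by
      rw [hU.mul_inf hb1, mul_smul_comm, mul_comm (1 - b) |u|, hab, smul_zero]
      exact inf_eq_right.2 (mul_nonneg hb1 hz)
    simp only [h5, range_const] at h4
    exact h4.unique isLUB_singleton
  linear_combination h3 - h2

theorem bandProj_eq_mul (hU : IsFAlgebra U) (u z : U) : bandProj u z = bandProj u 1 * z := by
  conv_rhs => rw [← posPart_sub_negPart z]
  rw [mul_sub, ← hU.iSup_inf_nsmul u (posPart_nonneg z), ← hU.iSup_inf_nsmul u (negPart_nonneg z)]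
  rfl

theorem projEq_eq_mul (hU : IsFAlgebra U) (x y z : U) : projEq x y z = projEq x y 1 * z := by
  rw [projEq, projEq, hU.bandProj_eq_mul _ z]
  ring

theorem projEq_idem (hU : IsFAlgebra U) (x y : U) : IsIdempotentElem (projEq x y 1) :=
  (hU.bandProj_one_idem |x - y|).one_sub

theorem projLe_idem (hU : IsFAlgebra U) (x y : U) : IsIdempotentElem (projLe x y 1) :=
  (hU.bandProj_one_idem (x - y)⁺).one_sub

theorem projEq_mul (hU : IsFAlgebra U) (x y : U) : projEq x y 1 * x = projEq x y 1 * y := by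
  have h : |projEq x y 1 * (x - y)| = 0 := by
    rw [← hU.mul_abs (hU.idem_nonneg (hU.projEq_idem x y)), mul_comm]
    have := hU.abs_mul_one_sub_bandProj |x - y|
    rwa [abs_abs] at this
  have h1 : projEq x y 1 * (x - y) = 0 := by
    refine le_antisymm ?_ ?_
    · rw [← h]; exact le_abs_self _
    · rw [← neg_nonpos, ← h]; exact neg_le_abs _
  rwa [mul_sub, sub_eq_zero] at h1

theorem mul_projEq_of_eq (hU : IsFAlgebra U) {c x y : U} (hc : 0 ≤ c) (h : c * x = c * y) :
    c * projEq x y 1 = c := by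
  have h1 : c * bandProj |x - y| 1 = 0 := by
    refine hU.mul_bandProj_eq_zero hc ?_
    rw [abs_abs, hU.mul_abs hc, mul_sub, h, sub_self, abs_zero]
  rw [projEq, mul_sub, h1, mul_one, sub_zero]

/-- On `c` both elements are constant, so `|x - y|` is at least `|r - t| > 0` there and `c` lies in
the band it generates. -/
theorem mul_projEq_of_ne (hU : IsFAlgebra U) {c x y : U} {r t : ℝ} (hc : 0 ≤ c)
    (hx : c * x = r • c) (hy : c * y = t • c) (hrt : r ≠ t) : c * projEq x y 1 = 0 := by
  have h1 : c * bandProj |x - y| 1 = c := by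
    refine hU.mul_bandProj_eq_self (abs_pos.2 (sub_ne_zero.2 hrt)) hc ?_
    rw [abs_abs, hU.mul_abs hc, mul_sub, hx, hy, ← sub_smul]
    rcases abs_choice (r - t) with h | h <;> rw [h]
    · exact le_abs_self _
    · rw [neg_smul]; exact neg_le_abs _
  rw [projEq, mul_sub, h1, mul_one, sub_self]

theorem mul_projLe_of_le (hU : IsFAlgebra U) {c x y : U} (hc : 0 ≤ c) (h : c * x ≤ c * y) :
    c * projLe x y 1 = c := by
  have h1 : c * bandProj (x - y)⁺ 1 = 0 := by
    refine hU.mul_bandProj_eq_zero hc ?_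
    rw [abs_of_nonneg (posPart_nonneg _), hU.mul_posPart hc, mul_sub, posPart_eq_zero]
    exact sub_nonpos.2 h
  rw [projLe, mul_sub, h1, mul_one, sub_zero]

theorem mul_projLe_of_lt (hU : IsFAlgebra U) {c x y : U} {r t : ℝ} (hc : 0 ≤ c)
    (hx : c * x = r • c) (hy : c * y = t • c) (hrt : t < r) : c * projLe x y 1 = 0 := by
  have h1 : c * bandProj (x - y)⁺ 1 = c := by
    refine hU.mul_bandProj_eq_self (sub_pos.2 hrt) hc ?_
    rw [abs_of_nonneg (posPart_nonneg _), hU.mul_posPart hc, mul_sub, hx, hy, ← sub_smul]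
    exact le_posPart _
  rw [projLe, mul_sub, h1, mul_one, sub_self]

end IsFAlgebra
end FAlgebra

/-! ### The universal completion and the extended conditional expectation -/

section Extension

open Set

variable {E : Type*} [ConditionallyCompleteLattice E] [AddCommGroup E] [IsOrderedAddMonoid E]
  [Module ℝ E] [IsOrderedModule ℝ E]
variable {U : Type*} [ConditionallyCompleteLattice U] [CommRing U] [IsOrderedRing U]
  [Algebra ℝ U] [IsOrderedModule ℝ U]
variable {e : E} {T : E →ₗ[ℝ] E} {ι : E →ₗ[ℝ] U}

theorem IsFAlgebra.isLUB_inf_natCast (hU : IsFAlgebra U) (u : U) :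
    IsLUB (range fun n : ℕ => u ⊓ (n : U)) u := by
  have hs : IsLUB (range fun n : ℕ => u ⊓ (n : U)) (⨆ n : ℕ, u ⊓ (n : U)) :=
    isLUB_ciSup ⟨u, by rintro _ ⟨n, rfl⟩; exact inf_le_left⟩
  set s := ⨆ n : ℕ, u ⊓ (n : U)
  have hsu : s ≤ u := hs.2 (by rintro _ ⟨n, rfl⟩; exact inf_le_left)
  have h1 : (u - s) * 1 = 0 := by
    refine hU.mul_eq_zero_of_inf (le_antisymm ?_ (le_inf (sub_nonneg.2 hsu) zero_le_one))
    have h1 : s ≤ s - (u - s) ⊓ 1 := hs.2 (by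
      rintro _ ⟨n, rfl⟩
      refine le_sub_iff_add_le.2 (le_trans (le_inf ?_ ?_) (hs.1 ⟨n + 1, rfl⟩))
      · calc u ⊓ (n : U) + (u - s) ⊓ 1 ≤ s + (u - s) := add_le_add (hs.1 ⟨n, rfl⟩) inf_le_left
          _ = u := by ring
      · rw [Nat.cast_succ]
        exact add_le_add inf_le_right inf_le_right)
    simpa using h1
  rw [mul_one, sub_eq_zero] at h1
  rwa [← h1] at hs

namespace IsUniversalCompletion

variable (hι : IsUniversalCompletion e ι)
include hι

theorem isFAlgebra : IsFAlgebra U := hι.mul_disjoint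

theorem le_iff {x y : E} : ι x ≤ ι y ↔ x ≤ y := by
  rw [← sup_eq_right, ← sup_eq_right, ← hι.map_sup, hι.injective.eq_iff]

theorem nonneg_iff {x : E} : 0 ≤ ι x ↔ 0 ≤ x := by
  rw [← map_zero ι, hι.le_iff]

/-- If `b` were an upper bound not above `ι A`, order density would put some `y > 0` of `E` under
the gap, and `A - y` would still bound the family in `E`. -/
theorem isLUB_map {κ : Type*} {a : κ → E} {A : E} (h : IsLUB (range a) A) :
    IsLUB (range fun k => ι (a k)) (ι A) := by
  refine ⟨by rintro _ ⟨k, rfl⟩; exact hι.le_iff.2 (h.1 ⟨k, rfl⟩), fun b hb => ?_⟩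
  by_contra hcon
  have h0 : 0 < ι A - ι A ⊓ b :=
    sub_pos.2 (lt_of_le_of_ne inf_le_left fun h => hcon (inf_eq_left.1 h))
  obtain ⟨y, hy0, hy⟩ := hι.order_dense _ h0
  have h1 : A ≤ A - y := h.2 (by
    rintro _ ⟨k, rfl⟩
    rw [← hι.le_iff, map_sub]
    refine le_sub_comm.1 (hy.trans (sub_le_sub_left (le_inf ?_ (hb ⟨k, rfl⟩)) _))
    exact hι.le_iff.2 (h.1 ⟨k, rfl⟩))
  exact absurd hy0 (not_lt_of_ge (by simpa using h1))

theorem isLUB_of_map {κ : Type*} {a : κ → E} {A : E}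
    (h : IsLUB (range fun k => ι (a k)) (ι A)) : IsLUB (range a) A := by
  refine ⟨by rintro _ ⟨k, rfl⟩; exact hι.le_iff.1 (h.1 ⟨k, rfl⟩), fun b hb => ?_⟩
  refine hι.le_iff.1 (h.2 ?_)
  rintro _ ⟨k, rfl⟩
  exact hι.le_iff.2 (hb ⟨k, rfl⟩)

/-- The Dedekind complete space `E` is an ideal of its universal completion. -/
theorem exists_map_eq {u : U} {x : E} (hu : 0 ≤ u) (hux : u ≤ ι x) :
    ∃ w : E, 0 ≤ w ∧ ι w = u := by
  -- The supremum of `D` in `E` is the preimage: an element of `E` in a remaining gap could be added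
  -- to it without leaving `D`.
  set D : Set E := {w | 0 ≤ w ∧ ι w ≤ u}
  have h0 : (0 : E) ∈ D := ⟨le_rfl, by rwa [map_zero]⟩
  have hb : BddAbove D := ⟨x, fun w hw => hι.le_iff.1 (hw.2.trans hux)⟩
  have hl : IsLUB D (sSup D) := isLUB_csSup ⟨0, h0⟩ hb
  have hw0 : 0 ≤ sSup D := hl.1 h0
  have hle : ι (sSup D) ≤ u := by
    have h1 : IsLUB (range fun w : D => (w : E)) (sSup D) := by rwa [Subtype.range_coe]
    refine (hι.isLUB_map h1).2 ?_
    rintro _ ⟨w, rfl⟩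
    exact w.2.2
  refine ⟨sSup D, hw0, le_antisymm hle ?_⟩
  by_contra hcon
  have h2 : 0 < u - ι (sSup D) := sub_pos.2 (lt_of_le_of_ne hle fun h => hcon h.ge)
  obtain ⟨y, hy0, hy⟩ := hι.order_dense _ h2
  have h3 : sSup D + y ≤ sSup D := hl.1 ⟨add_nonneg hw0 hy0.le, by
    rw [map_add]
    exact le_sub_iff_add_le'.1 hy⟩
  exact absurd hy0 (not_lt_of_ge (by simpa using h3))

theorem map_nsmul_unit (n : ℕ) : ι (n • e) = n := by
  rw [map_nsmul, hι.map_unit, nsmul_one]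

theorem exists_map_eq_of_le_natCast {u : U} {n : ℕ} (hu : 0 ≤ u) (hun : u ≤ n) :
    ∃ w : E, 0 ≤ w ∧ ι w = u :=
  hι.exists_map_eq hu (hun.trans (hι.map_nsmul_unit n).ge)

end IsUniversalCompletion

/-- The positive element `u` belongs to the domain of the extended conditional expectation,
with value `a`. -/
def HasExp (T : E →ₗ[ℝ] E) (ι : E →ₗ[ℝ] U) (u a : U) : Prop :=
  0 ≤ u ∧ IsLUB (lowerValues T ι u) a

theorem lowerValues_mono {u v : U} (h : u ≤ v) : lowerValues T ι u ⊆ lowerValues T ι v :=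
  fun _ ⟨w, hw, hwu, hz⟩ => ⟨w, hw, hwu.trans h, hz⟩

theorem lowerValues_nonempty {u : U} (hu : 0 ≤ u) : (lowerValues T ι u).Nonempty :=
  ⟨ι (T 0), 0, le_rfl, by rwa [map_zero], rfl⟩

theorem HasExp.inL1 {u a : U} (h : HasExp T ι u a) : InL1 T ι u := by
  rw [InL1, abs_of_nonneg h.1]
  exact ⟨a, h.2.1⟩

theorem HasExp.nonneg_val {u a : U} (h : HasExp T ι u a) : 0 ≤ a :=
  h.2.1 ⟨0, le_rfl, by rw [map_zero]; exact h.1, by simp⟩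

theorem HasExp.unique {u a b : U} (h : HasExp T ι u a) (h' : HasExp T ι u b) : a = b :=
  h.2.unique h'.2

theorem HasExp.mono {u v a b : U} (h : HasExp T ι u a) (h' : HasExp T ι v b) (huv : u ≤ v) :
    a ≤ b :=
  h.2.2 fun _ hz => h'.2.1 (lowerValues_mono huv hz)

theorem HasExp.exists_of_le {u v b : U} (hu : 0 ≤ u) (h : HasExp T ι v b) (huv : u ≤ v) :
    ∃ a, HasExp T ι u a :=
  ⟨_, hu, isLUB_csSup (lowerValues_nonempty hu) ⟨b, fun _ hz => h.2.1 (lowerValues_mono huv hz)⟩⟩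

theorem hasExp_of_inL1 {u : U} (hu : 0 ≤ u) (h : InL1 T ι u) : ∃ a, HasExp T ι u a := by
  rw [InL1, abs_of_nonneg hu] at h
  exact ⟨_, hu, isLUB_csSup (lowerValues_nonempty hu) h⟩

variable (hT : IsConditionalRieszTriple e T) (hι : IsUniversalCompletion e ι)
include hT hι

theorem IsConditionalRieszTriple.mono {x y : E} (h : x ≤ y) : T x ≤ T y := by
  have := hT.nonneg (y - x) (sub_nonneg.2 h)
  rwa [map_sub, sub_nonneg] at this

theorem hasExp_map {w : E} (hw : 0 ≤ w) : HasExp T ι (ι w) (ι (T w)) := by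
  refine ⟨hι.nonneg_iff.2 hw, ?_, fun b hb => hb ⟨w, hw, le_rfl, rfl⟩⟩
  rintro _ ⟨v, hv, hvw, rfl⟩
  exact hι.le_iff.2 (hT.mono hι (hι.le_iff.1 hvw))

theorem hasExp_zero : HasExp T ι 0 0 := by
  simpa using hasExp_map hT hι (le_refl (0 : E))

theorem hasExp_one : HasExp T ι 1 1 := by
  have := hasExp_map hT hι hT.unit_nonneg
  rwa [hT.map_unit, hι.map_unit] at this

theorem HasExp.condExp_eq {u a : U} (h : HasExp T ι u a) : condExp T ι u = a := by
  rw [condExp, posPart_of_nonneg h.1, negPart_of_nonneg h.1,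
    h.2.csSup_eq (lowerValues_nonempty h.1),
    (hasExp_zero hT hι).2.csSup_eq (lowerValues_nonempty le_rfl), sub_zero]

theorem hasExp_condExp {u : U} (hu : 0 ≤ u) (h : InL1 T ι u) : HasExp T ι u (condExp T ι u) := by
  obtain ⟨a, ha⟩ := hasExp_of_inL1 hu h
  rwa [ha.condExp_eq hT hι]

theorem hasExp_of_le_natCast {u : U} {n : ℕ} (hu : 0 ≤ u) (hun : u ≤ n) :
    HasExp T ι u (condExp T ι u) := by
  obtain ⟨w, hw, rfl⟩ := hι.exists_map_eq_of_le_natCast hu hun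
  exact hasExp_condExp hT hι hu (hasExp_map hT hι hw).inL1

/-- Monotone convergence. -/
theorem hasExp_iff_of_monotone {u a : ℕ → U} {v A : U} (hu : Monotone u)
    (ha : ∀ n, HasExp T ι (u n) (a n)) (hv : IsLUB (range u) v) :
    HasExp T ι v A ↔ IsLUB (range a) A := by
  have hv0 : 0 ≤ v := (ha 0).1.trans (hv.1 ⟨0, rfl⟩)
  -- Comparing upper bounds, rather than suprema, also settles whether the expectation is finite.
  have key : upperBounds (lowerValues T ι v) = upperBounds (range a) := by
    ext b
    constructor
    · rintro hb _ ⟨n, rfl⟩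
      exact (ha n).2.2 fun z hz => hb (lowerValues_mono (hv.1 ⟨n, rfl⟩) hz)
    · rintro hb _ ⟨w, hw, hwv, rfl⟩
      -- The truncations of `w` by `u n` lie in `E`, which is an ideal, and increase to `w`, so
      -- order continuity of `T` on `E` applies.
      have h1 : ∀ n, ∃ y : E, 0 ≤ y ∧ ι y = ι w ⊓ u n := fun n =>
        hι.exists_map_eq (le_inf (hι.nonneg_iff.2 hw) (ha n).1) inf_le_left
      choose y hy0 hy using h1
      have h2 : IsLUB (range fun n => ι (y n)) (ι w) := by
        have h3 := isLUB_inf_range hv (ι w)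
        rw [inf_eq_left.2 hwv] at h3
        simpa only [hy] using h3
      have hmono : Monotone y := fun m n hmn => by
        rw [← hι.le_iff, hy, hy]
        exact inf_le_inf_left _ (hu hmn)
      have h4 := hT.order_cont (range y) (range_nonempty y)
        (directedOn_range.2 hmono.directed_le) w (hι.isLUB_of_map h2)
      rw [← range_comp] at h4
      refine (hι.isLUB_map h4).2 ?_
      rintro _ ⟨n, rfl⟩
      refine le_trans ?_ (hb ⟨n, rfl⟩)
      exact (hasExp_map hT hι (hy0 n)).mono (ha n) ((hy n).le.trans inf_le_right)
  rw [HasExp, IsLUB, key]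
  exact ⟨fun h => h.2, fun h => ⟨hv0, h⟩⟩

/-- The device that carries properties of `T` from `E` to unbounded elements of `U`, via monotone
convergence. -/
theorem exists_monotone_map {u : U} (hu : 0 ≤ u) : ∃ w : ℕ → E, Monotone w ∧ (∀ n, 0 ≤ w n) ∧
    (∀ n, ι (w n) = u ⊓ (n : U)) ∧ IsLUB (range fun n => ι (w n)) u := by
  have h1 : ∀ n : ℕ, ∃ y : E, 0 ≤ y ∧ ι y = u ⊓ (n : U) := fun n =>
    hι.exists_map_eq_of_le_natCast (le_inf hu (Nat.cast_nonneg n)) inf_le_right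
  choose y hy0 hy using h1
  refine ⟨y, fun m n hmn => ?_, hy0, hy, ?_⟩
  · rw [← hι.le_iff, hy, hy]
    exact inf_le_inf_left _ (Nat.mono_cast hmn)
  · simpa only [hy] using hι.isFAlgebra.isLUB_inf_natCast u

theorem monotone_map_comp {w : ℕ → E} (hw : Monotone w) :
    (Monotone fun n => ι (w n)) ∧ Monotone fun n => ι (T (w n)) :=
  ⟨fun _ _ h => hι.le_iff.2 (hw h), fun _ _ h => hι.le_iff.2 (hT.mono hι (hw h))⟩

theorem HasExp.add {u v a b : U} (hu : HasExp T ι u a) (hv : HasExp T ι v b) :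
    HasExp T ι (u + v) (a + b) := by
  obtain ⟨x, hx, hx0, -, hxu⟩ := exists_monotone_map hT hι hu.1
  obtain ⟨y, hy, hy0, -, hyv⟩ := exists_monotone_map hT hι hv.1
  have hx' := monotone_map_comp hT hι hx
  have hy' := monotone_map_comp hT hι hy
  have h1 := (hasExp_iff_of_monotone hT hι hx'.1 (fun n => hasExp_map hT hι (hx0 n)) hxu).1 hu
  have h2 := (hasExp_iff_of_monotone hT hι hy'.1 (fun n => hasExp_map hT hι (hy0 n)) hyv).1 hv
  refine (hasExp_iff_of_monotone hT hι (hx'.1.add hy'.1) (fun n => ?_)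
    (isLUB_add_range hxu hyv hx'.1 hy'.1)).2 (isLUB_add_range h1 h2 hx'.2 hy'.2)
  have := hasExp_map hT hι (add_nonneg (hx0 n) (hy0 n))
  rwa [map_add, map_add, map_add] at this

theorem HasExp.smul {u a : U} (hu : HasExp T ι u a) {r : ℝ} (hr : 0 ≤ r) :
    HasExp T ι (r • u) (r • a) := by
  obtain ⟨x, hx, hx0, -, hxu⟩ := exists_monotone_map hT hι hu.1
  have hx' := monotone_map_comp hT hι hx
  have h1 := (hasExp_iff_of_monotone hT hι hx'.1 (fun n => hasExp_map hT hι (hx0 n)) hxu).1 hu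
  have hr1 : (0 : U) ≤ r • 1 := smul_nonneg hr zero_le_one
  have h2 := hι.isFAlgebra.isLUB_mul hxu hr1
  have h3 := hι.isFAlgebra.isLUB_mul h1 hr1
  simp only [smul_mul_assoc, one_mul] at h2 h3
  refine (hasExp_iff_of_monotone hT hι (fun m n h => smul_le_smul_of_nonneg_left (hx'.1 h) hr)
    (fun n => ?_) h2).2 h3
  have := hasExp_map hT hι (smul_nonneg hr (hx0 n))
  rwa [map_smul, map_smul, map_smul] at this

theorem HasExp.sum {κ : Type*} (s : Finset κ) {u a : κ → U}
    (h : ∀ k ∈ s, HasExp T ι (u k) (a k)) : HasExp T ι (∑ k ∈ s, u k) (∑ k ∈ s, a k) := by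
  classical
  induction s using Finset.induction_on with
  | empty => simpa using hasExp_zero hT hι
  | insert k s hk ih =>
    rw [Finset.sum_insert hk, Finset.sum_insert hk]
    exact (h k (Finset.mem_insert_self k s)).add hT hι
      (ih fun j hj => h j (Finset.mem_insert_of_mem hj))

/-- Additivity on positive elements, applied to `u + (u - v)⁻ = v + (u - v)⁺`, makes the value
independent of the chosen decomposition. -/
theorem HasExp.condExp_sub {u v a b : U} (hu : HasExp T ι u a) (hv : HasExp T ι v b) :
    condExp T ι (u - v) = a - b := by
  have hp : (u - v)⁺ ≤ u := by
    rw [posPart_def]; exact sup_le (sub_le_self _ hv.1) hu.1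
  have hn : (u - v)⁻ ≤ v := by
    rw [negPart_def, neg_sub]; exact sup_le (sub_le_self _ hu.1) hv.1
  obtain ⟨c, hc⟩ := HasExp.exists_of_le (posPart_nonneg _) hu hp
  obtain ⟨d, hd⟩ := HasExp.exists_of_le (negPart_nonneg _) hv hn
  have h1 := hu.add hT hι hd
  have h2 := hv.add hT hι hc
  have h3 : u + (u - v)⁻ = v + (u - v)⁺ := by
    linear_combination -(posPart_sub_negPart (u - v))
  rw [h3] at h1
  rw [condExp, hc.2.csSup_eq (lowerValues_nonempty hc.1),
    hd.2.csSup_eq (lowerValues_nonempty hd.1)]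
  linear_combination h2.unique h1

theorem condExp_decomp {u : U} (h : InL1 T ι u) : ∃ a b, HasExp T ι u⁺ a ∧ HasExp T ι u⁻ b := by
  obtain ⟨c, hc⟩ := hasExp_of_inL1 (T := T) (ι := ι) (abs_nonneg u) (by rwa [InL1, abs_abs])
  obtain ⟨a, ha⟩ := HasExp.exists_of_le (posPart_nonneg u) hc (sup_le (le_abs_self u) (abs_nonneg u))
  obtain ⟨b, hb⟩ := HasExp.exists_of_le (negPart_nonneg u) hc (sup_le (neg_le_abs u) (abs_nonneg u))
  exact ⟨a, b, ha, hb⟩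

end Extension

/-! ### The averaging property and the two forms of the conditional variance -/

section Averaging

open Set

variable {E : Type*} [ConditionallyCompleteLattice E] [AddCommGroup E] [IsOrderedAddMonoid E]
  [Module ℝ E] [IsOrderedModule ℝ E]
variable {U : Type*} [ConditionallyCompleteLattice U] [CommRing U] [IsOrderedRing U]
  [Algebra ℝ U] [IsOrderedModule ℝ U]
variable {e : E} {T : E →ₗ[ℝ] E} {ι : E →ₗ[ℝ] U}

/-- The range of `T`, as a subspace of the universal completion. -/
def rangeIn (T : E →ₗ[ℝ] E) (ι : E →ₗ[ℝ] U) : Submodule ℝ U := (LinearMap.range T).map ι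

/-- `f` can be taken out of conditional expectations. -/
def Averages (T : E →ₗ[ℝ] E) (ι : E →ₗ[ℝ] U) (f : U) : Prop :=
  0 ≤ f ∧ ∀ u a, HasExp T ι u a → HasExp T ι (f * u) (f * a)

variable (hT : IsConditionalRieszTriple e T) (hι : IsUniversalCompletion e ι)
include hT hι

theorem map_mem_rangeIn (w : E) : ι (T w) ∈ rangeIn T ι := ⟨T w, ⟨w, rfl⟩, rfl⟩

theorem one_mem_rangeIn : (1 : U) ∈ rangeIn T ι := by
  have := map_mem_rangeIn hT hι e
  rwa [hT.map_unit, hι.map_unit] at this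

theorem sup_mem_rangeIn {u v : U} (hu : u ∈ rangeIn T ι) (hv : v ∈ rangeIn T ι) :
    u ⊔ v ∈ rangeIn T ι := by
  obtain ⟨_, ⟨x, rfl⟩, rfl⟩ := hu
  obtain ⟨_, ⟨y, rfl⟩, rfl⟩ := hv
  obtain ⟨z, hz⟩ := hT.range_sup x y
  rw [← hι.map_sup, ← hz]
  exact map_mem_rangeIn hT hι z

theorem inf_mem_rangeIn {u v : U} (hu : u ∈ rangeIn T ι) (hv : v ∈ rangeIn T ι) :
    u ⊓ v ∈ rangeIn T ι := by
  have := neg_mem (sup_mem_rangeIn hT hι (neg_mem hu) (neg_mem hv))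
  rwa [← neg_inf, neg_neg] at this

theorem hasExp_self_of_mem_rangeIn {u : U} (hu : u ∈ rangeIn T ι) (h0 : 0 ≤ u) :
    HasExp T ι u u := by
  obtain ⟨_, ⟨x, rfl⟩, rfl⟩ := hu
  have := hasExp_map hT hι (hι.nonneg_iff.1 h0)
  rwa [hT.idem] at this

/-- The approximants `1 ⊓ n f` stay in the range, where `T` is the identity, and monotone
convergence passes to the limit. -/
theorem hasExp_self_bandProj {f : U} (hf : f ∈ rangeIn T ι) (h0 : 0 ≤ f) :
    HasExp T ι (bandProj f 1) (bandProj f 1) := by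
  have h1 := IsFAlgebra.isLUB_bandProj_one f
  rw [abs_of_nonneg h0] at h1
  refine (hasExp_iff_of_monotone hT hι (fun m n h => ?_) (fun n => ?_) h1).2 h1
  · exact inf_le_inf_left _ (nsmul_le_nsmul_left h0 h)
  · exact hasExp_self_of_mem_rangeIn hT hι
      (inf_mem_rangeIn hT hι (one_mem_rangeIn hT hι) (nsmul_mem hf n))
      (le_inf zero_le_one (nsmul_nonneg h0 n))

theorem averages_of_natCast {f : U} (hf : 0 ≤ f)
    (h : ∀ (u a : U) (n : ℕ), u ≤ n → HasExp T ι u a → HasExp T ι (f * u) (f * a)) :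
    Averages T ι f := by
  refine ⟨hf, fun u a hu => ?_⟩
  obtain ⟨x, hx, hx0, hxn, hxu⟩ := exists_monotone_map hT hι hu.1
  have hx' := monotone_map_comp hT hι hx
  have h1 := (hasExp_iff_of_monotone hT hι hx'.1 (fun n => hasExp_map hT hι (hx0 n)) hxu).1 hu
  exact (hasExp_iff_of_monotone hT hι (fun m n h => mul_le_mul_of_nonneg_left (hx'.1 h) hf)
    (fun n => h _ _ n ((hxn n).trans_le inf_le_right) (hasExp_map hT hι (hx0 n)))
    (hι.isFAlgebra.isLUB_mul hxu hf)).2 (hι.isFAlgebra.isLUB_mul h1 hf)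

theorem Averages.of_monotone {f : ℕ → U} {g : U} (hf : ∀ n, Averages T ι (f n)) (hm : Monotone f)
    (h : IsLUB (range f) g) : Averages T ι g := by
  refine ⟨(hf 0).1.trans (h.1 ⟨0, rfl⟩), fun u a hu => ?_⟩
  have h1 := hι.isFAlgebra.isLUB_mul h hu.1
  have h2 := hι.isFAlgebra.isLUB_mul h hu.nonneg_val
  simp only [mul_comm u, mul_comm a] at h1 h2
  exact (hasExp_iff_of_monotone hT hι (fun m n h => mul_le_mul_of_nonneg_right (hm h) hu.1)
    (fun n => (hf n).2 u a hu) h1).2 h2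

theorem Averages.smul {f : U} (hf : Averages T ι f) {r : ℝ} (hr : 0 ≤ r) :
    Averages T ι (r • f) := by
  refine ⟨smul_nonneg hr hf.1, fun u a hu => ?_⟩
  rw [smul_mul_assoc, smul_mul_assoc]
  exact (hf.2 u a hu).smul hT hι hr

theorem Averages.sum {κ : Type*} (s : Finset κ) {f : κ → U} (hf : ∀ k ∈ s, Averages T ι (f k)) :
    Averages T ι (∑ k ∈ s, f k) := by
  refine ⟨Finset.sum_nonneg fun k hk => (hf k hk).1, fun u a hu => ?_⟩
  rw [Finset.sum_mul, Finset.sum_mul]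
  exact HasExp.sum hT hι s fun k hk => (hf k hk).2 u a hu

/-- For `u ≤ n` the expectation of `p u` is at most `n p`, so `1 - p` kills it; likewise `p` kills
that of `(1 - p) u`. Multiplying the sum of the two by `p` leaves the first. -/
theorem averages_idem {p : U} (hp : IsIdempotentElem p) (h : HasExp T ι p p) :
    Averages T ι p := by
  have hU := hι.isFAlgebra
  have hp0 := hU.idem_nonneg hp
  have hq0 := hU.idem_nonneg hp.one_sub
  have hq : HasExp T ι (1 - p) (1 - p) := by
    obtain ⟨b, hb⟩ := HasExp.exists_of_le hq0 (hasExp_one hT hι) (sub_le_self 1 hp0)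
    have h1 := h.add hT hι hb
    rw [add_sub_cancel] at h1
    have h2 := h1.unique (hasExp_one hT hι)
    rwa [eq_sub_of_add_eq' h2] at hb
  refine averages_of_natCast hT hι hp0 fun u a n hun hu => ?_
  have hle : ∀ q : U, 0 ≤ q → q * u ≤ (n : ℝ) • q := fun q hq => by
    rw [Nat.cast_smul_eq_nsmul, nsmul_eq_mul, mul_comm]
    exact mul_le_mul_of_nonneg_right hun hq
  have hn : (0 : ℝ) ≤ n := Nat.cast_nonneg n
  obtain ⟨a₁, h₁⟩ := HasExp.exists_of_le (mul_nonneg hp0 hu.1) (h.smul hT hι hn) (hle p hp0)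
  obtain ⟨a₂, h₂⟩ := HasExp.exists_of_le (mul_nonneg hq0 hu.1) (hq.smul hT hι hn) (hle _ hq0)
  have h3 : a = a₁ + a₂ := hu.unique (by
    have := h₁.add hT hι h₂
    rwa [← add_mul, add_sub_cancel, one_mul] at this)
  have h4 := mul_le_mul_of_nonneg_left (h₁.mono (h.smul hT hι hn) (hle p hp0)) hq0
  have h5 := mul_le_mul_of_nonneg_left (h₂.mono (hq.smul hT hι hn) (hle _ hq0)) hp0
  rw [mul_smul_comm, hp.one_sub_mul_self, smul_zero] at h4
  rw [mul_smul_comm, hp.mul_one_sub_self, smul_zero] at h5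
  have h6 := le_antisymm h4 (mul_nonneg hq0 h₁.nonneg_val)
  have h7 := le_antisymm h5 (mul_nonneg hp0 h₂.nonneg_val)
  have h8 : p * a = a₁ := by rw [h3]; linear_combination h7 - h6
  rwa [h8]

/-- The slice of `f` between heights `s` and `s + r` has full thickness `r` where `f > s + r`, and
is at most `r` and supported where `f > s`. -/
theorem layer_bounds {f : U} {s r : ℝ} (hr : 0 ≤ r) :
    r • bandProj (f - algebraMap ℝ U (s + r))⁺ 1 ≤
        (f - algebraMap ℝ U s)⁺ - (f - algebraMap ℝ U (s + r))⁺ ∧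
      (f - algebraMap ℝ U s)⁺ - (f - algebraMap ℝ U (s + r))⁺ ≤
        r • bandProj (f - algebraMap ℝ U s)⁺ 1 := by
  have hU := hι.isFAlgebra
  have hr1 : (0 : U) ≤ r • 1 := smul_nonneg hr zero_le_one
  have hg : f - algebraMap ℝ U s = (f - algebraMap ℝ U (s + r)) + r • 1 := by
    rw [map_add, Algebra.algebraMap_eq_smul_one r]; ring
  rw [hg]
  set g := f - algebraMap ℝ U (s + r)
  have hmono : g⁺ ≤ (g + r • 1)⁺ := posPart_mono (le_add_of_nonneg_right hr1)
  have hh : 0 ≤ (g + r • 1)⁺ - g⁺ := sub_nonneg.2 hmono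
  have hband : ∀ v : U, v⁺ * (1 - bandProj v⁺ 1) = 0 := fun v => by
    have := hU.abs_mul_one_sub_bandProj v⁺
    rwa [abs_of_nonneg (posPart_nonneg _)] at this
  constructor
  · have hp0 := IsFAlgebra.bandProj_one_nonneg g⁺
    have hp1 := IsFAlgebra.bandProj_one_le g⁺
    have h1 : bandProj g⁺ 1 * g⁻ = 0 := by
      rw [mul_comm]
      refine hU.mul_bandProj_eq_zero (negPart_nonneg _) ?_
      rw [abs_of_nonneg (posPart_nonneg _), mul_comm]
      exact hU.posPart_mul_negPart g
    have h2 := mul_le_mul_of_nonneg_left (le_posPart (g + r • 1)) hp0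
    have h3 : bandProj g⁺ 1 * (g + r • 1) = bandProj g⁺ 1 * g⁺ + r • bandProj g⁺ 1 := by
      rw [mul_add, mul_smul_comm, mul_one]
      linear_combination (-bandProj g⁺ 1) * (posPart_sub_negPart g) - h1
    rw [h3] at h2
    calc r • bandProj g⁺ 1 ≤ bandProj g⁺ 1 * ((g + r • 1)⁺ - g⁺) := by
          rw [mul_sub]; exact le_sub_iff_add_le'.2 h2
      _ ≤ 1 * ((g + r • 1)⁺ - g⁺) := mul_le_mul_of_nonneg_right hp1 hh
      _ = _ := one_mul _
  · have hp0 := IsFAlgebra.bandProj_one_nonneg (g + r • 1)⁺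
    have hp1 : 0 ≤ 1 - bandProj (g + r • 1)⁺ 1 := sub_nonneg.2 (IsFAlgebra.bandProj_one_le _)
    have h1 : (g + r • 1)⁺ ≤ g⁺ + r • 1 := by
      rw [posPart_def]
      exact sup_le (add_le_add_left (le_posPart g) _) (add_nonneg (posPart_nonneg g) hr1)
    have h2 := hband (g + r • 1)
    have h3 : g⁺ * (1 - bandProj (g + r • 1)⁺ 1) = 0 :=
      le_antisymm ((mul_le_mul_of_nonneg_right hmono hp1).trans h2.le)
        (mul_nonneg (posPart_nonneg g) hp1)
    calc (g + r • 1)⁺ - g⁺ = bandProj (g + r • 1)⁺ 1 * ((g + r • 1)⁺ - g⁺) := by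
          linear_combination h2 - h3
      _ ≤ bandProj (g + r • 1)⁺ 1 * (r • 1) :=
          mul_le_mul_of_nonneg_left (sub_le_iff_le_add'.2 h1) hp0
      _ = _ := by rw [mul_smul_comm, mul_one]

/-- Cut `f` into `m` layers of height `1/m` and bound each from both sides. The lower and upper step
functions are shifts of one another, so their difference telescopes to at most `1/m`. -/
theorem exists_averages_approx {f : U} (hf : f ∈ rangeIn T ι) (h0 : 0 ≤ f) (h1 : f ≤ 1)
    {m : ℕ} (hm : 0 < m) : ∃ g h : U, Averages T ι g ∧ Averages T ι h ∧ g ≤ f ∧ f ≤ h ∧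
      m • (h - g) ≤ 1 := by
  have hU := hι.isFAlgebra
  set r : ℝ := (m : ℝ)⁻¹
  have hr0 : 0 ≤ r := by positivity
  set F : ℕ → U := fun k => (f - algebraMap ℝ U (k * r))⁺ with hF
  set p : ℕ → U := fun k => bandProj (F k) 1
  have hmem : ∀ k, F k ∈ rangeIn T ι := fun k => by
    simp only [hF, posPart_def, Algebra.algebraMap_eq_smul_one]
    exact sup_mem_rangeIn hT hι
      (sub_mem hf (Submodule.smul_mem _ _ (one_mem_rangeIn hT hι))) (zero_mem _)
  have hav : ∀ k, Averages T ι (r • p k) := fun k =>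
    (averages_idem hT hι (hU.bandProj_one_idem (F k))
      (hasExp_self_bandProj hT hι (hmem k) (posPart_nonneg _))).smul hT hι hr0
  have hb : ∀ k, r • p (k + 1) ≤ F k - F (k + 1) ∧ F k - F (k + 1) ≤ r • p k := fun k => by
    have := layer_bounds (f := f) (s := k * r) hT hι hr0
    have h2 : (k : ℝ) * r + r = ((k + 1 : ℕ) : ℝ) * r := by push_cast; ring
    rwa [h2] at this
  have hsum : ∑ k ∈ Finset.range m, (F k - F (k + 1)) = f := by
    rw [Finset.sum_range_sub']
    have h3 : (m : ℝ) * r = 1 := mul_inv_cancel₀ (by positivity)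
    simp only [hF, h3, Nat.cast_zero, zero_mul, map_zero, sub_zero, map_one]
    rw [posPart_of_nonneg h0, posPart_eq_zero.2 (sub_nonpos.2 h1), sub_zero]
  refine ⟨∑ k ∈ Finset.range m, r • p (k + 1), ∑ k ∈ Finset.range m, r • p k,
    Averages.sum hT hι _ fun k _ => hav _, Averages.sum hT hι _ fun k _ => hav _,
    (Finset.sum_le_sum fun k _ => (hb k).1).trans hsum.le,
    hsum.ge.trans (Finset.sum_le_sum fun k _ => (hb k).2), ?_⟩
  rw [← Finset.sum_sub_distrib, Finset.sum_range_sub' fun k => r • p k,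
    ← Nat.cast_smul_eq_nsmul ℝ, ← smul_sub, smul_smul, mul_inv_cancel₀ (by positivity), one_smul]
  exact (sub_le_self _ (IsFAlgebra.bandProj_one_nonneg _)).trans (IsFAlgebra.bandProj_one_le _)

theorem averages_of_mem_rangeIn_of_le_one {f : U} (hf : f ∈ rangeIn T ι) (h0 : 0 ≤ f)
    (h1 : f ≤ 1) : Averages T ι f := by
  refine ⟨h0, fun u a hu => ?_⟩
  have ha0 := hu.nonneg_val
  obtain ⟨d, hd⟩ := HasExp.exists_of_le (mul_nonneg h0 hu.1) hu
    (by simpa using mul_le_mul_of_nonneg_right h1 hu.1)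
  suffices h : d = f * a by rwa [h] at hd
  -- Both `d` and `f a` lie between `g a` and `h a`, which differ by at most `a/m`.
  have key : ∀ m : ℕ, m • (d - f * a) ≤ a ∧ m • (f * a - d) ≤ a := fun m => by
    rcases Nat.eq_zero_or_pos m with rfl | hm
    · simp [ha0]
    obtain ⟨g, h, hg, hh, hgf, hfh, hgh⟩ := exists_averages_approx hT hι hf h0 h1 hm
    have h3 := (hg.2 u a hu).mono hd (mul_le_mul_of_nonneg_right hgf hu.1)
    have h4 := hd.mono (hh.2 u a hu) (mul_le_mul_of_nonneg_right hfh hu.1)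
    have h5 := mul_le_mul_of_nonneg_right hgf ha0
    have h6 := mul_le_mul_of_nonneg_right hfh ha0
    have h7 := mul_le_mul_of_nonneg_right hgh ha0
    rw [one_mul, smul_mul_assoc, sub_mul] at h7
    exact ⟨(nsmul_le_nsmul_right (sub_le_sub h4 h5) m).trans h7,
      (nsmul_le_nsmul_right (sub_le_sub h6 h3) m).trans h7⟩
  exact le_antisymm (sub_nonpos.1 (nonpos_of_nsmul_le fun m => (key m).1))
    (sub_nonpos.1 (nonpos_of_nsmul_le fun m => (key m).2))

/-- The averaging property of `T`, for elements of the range of `T`. -/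
theorem averages_of_mem_rangeIn {f : U} (hf : f ∈ rangeIn T ι) (h0 : 0 ≤ f) :
    Averages T ι f := by
  -- Truncation at `n + 1`, not `n`, so that one can divide by the bound.
  have h1 : ∀ n : ℕ, Averages T ι (f ⊓ ((n + 1 : ℕ) : U)) := fun n => by
    have hn : (0 : ℝ) < ((n + 1 : ℕ) : ℝ) := by positivity
    have hn1 : ((n + 1 : ℕ) : U) = ((n + 1 : ℕ) : ℝ) • 1 := by
      rw [Nat.cast_smul_eq_nsmul, nsmul_one]
    have hmem : f ⊓ ((n + 1 : ℕ) : U) ∈ rangeIn T ι := by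
      rw [hn1]
      exact inf_mem_rangeIn hT hι hf (Submodule.smul_mem _ _ (one_mem_rangeIn hT hι))
    have h2 := averages_of_mem_rangeIn_of_le_one hT hι
      (Submodule.smul_mem _ ((n + 1 : ℕ) : ℝ)⁻¹ hmem)
      (smul_nonneg (by positivity) (le_inf h0 (Nat.cast_nonneg _)))
      ((inv_smul_le_iff_of_pos hn).2 (inf_le_right.trans hn1.le))
    have h3 := h2.smul hT hι hn.le
    rwa [smul_inv_smul₀ hn.ne'] at h3
  refine Averages.of_monotone hT hι h1 (fun m n h => ?_)
    (isLUB_range_of_cofinal (hι.isFAlgebra.isLUB_inf_natCast f) (fun n => ⟨n, ?_⟩) fun n => ?_)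
  · exact inf_le_inf_left _ (Nat.mono_cast (Nat.succ_le_succ h))
  · exact inf_le_inf_left _ (Nat.mono_cast (Nat.le_succ n))
  · exact inf_le_left

/-- Values of the extended conditional expectation can be taken out of expectations. -/
theorem HasExp.averages {u a : U} (hu : HasExp T ι u a) : Averages T ι a := by
  obtain ⟨x, hx, hx0, -, hxu⟩ := exists_monotone_map hT hι hu.1
  have hx' := monotone_map_comp hT hι hx
  have h1 := (hasExp_iff_of_monotone hT hι hx'.1 (fun n => hasExp_map hT hι (hx0 n)) hxu).1 hu
  exact Averages.of_monotone hT hι (fun n => averages_of_mem_rangeIn hT hι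
    (map_mem_rangeIn hT hι (x n)) (hasExp_map hT hι (hx0 n)).nonneg_val) hx'.2 h1

theorem Averages.hasExp_self {f : U} (hf : Averages T ι f) : HasExp T ι f f := by
  simpa using hf.2 1 1 (hasExp_one hT hι)

theorem condVar_eq {y : U} (hy : InLp T ι 2 y) :
    condVar T ι y = condExp T ι (y ^ 2) - condExp T ι y ^ 2 := by
  have hU := hι.isFAlgebra
  have hsq : |y| ^ 2 = y ^ 2 := by
    have h1 : |y| = y⁺ + y⁻ := (posPart_add_negPart y).symm
    have h2 := posPart_sub_negPart y
    have h3 := hU.posPart_mul_negPart y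
    rw [h1]
    linear_combination 4 * h3 + (y⁺ - y⁻ + y) * h2
  have hy0 : 0 ≤ y ^ 2 := by rw [sq]; exact hU.mul_self_nonneg y
  rw [InLp, hsq] at hy
  have hy2 := hasExp_condExp hT hι hy0 hy
  set b := condExp T ι (y ^ 2)
  -- Square integrability gives integrability, from `(1 - |y|)² ≥ 0`.
  have habs : |y| ≤ 1 + y ^ 2 := by
    have h1 := hU.mul_self_nonneg (1 - |y|)
    have h2 : (1 - |y|) * (1 - |y|) = 1 + y ^ 2 - |y| - |y| := by rw [← hsq]; ring
    rw [h2] at h1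
    exact (sub_nonneg.1 h1).trans (sub_le_self _ (abs_nonneg y))
  have h1 := (hasExp_one hT hι).add hT hι hy2
  obtain ⟨c, hc⟩ := HasExp.exists_of_le (abs_nonneg y) h1 habs
  obtain ⟨α, β, hα, hβ⟩ := condExp_decomp hT hι (u := y) (by
    have := hc.inL1
    rwa [InL1, abs_abs] at this)
  have hyαβ : condExp T ι y = α - β := by
    conv_lhs => rw [← posPart_sub_negPart y]
    exact hα.condExp_sub hT hι hβ
  have hα' := hα.averages hT hι
  have hβ' := hβ.averages hT hι
  have hαα := hα'.2 _ _ hα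
  have hαβ := hα'.2 _ _ hβ
  have hβα := hβ'.2 _ _ hα
  have hββ := hβ'.2 _ _ hβ
  have hα2 := hα'.2 _ _ (hα'.hasExp_self hT hι)
  have hβ2 := hβ'.2 _ _ (hβ'.hasExp_self hT hι)
  have hab := hα'.2 _ _ (hβ'.hasExp_self hT hι)
  -- With `T y = α - β`, the expanded square `(y - T y)²` is sorted into its positive and its
  -- negative terms, since `HasExp` only covers positive elements.
  have hP := ((((hy2.add hT hι hα2).add hT hι hβ2).add hT hι (hαβ.add hT hι hαβ)).add hT hι
    (hβα.add hT hι hβα))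
  have hM := (((hαα.add hT hι hαα).add hT hι (hββ.add hT hι hββ)).add hT hι (hab.add hT hι hab))
  have h2 := hP.condExp_sub hT hι hM
  rw [condVar, hyαβ]
  have h3 : (y - (α - β)) ^ 2 = (y ^ 2 + α * α + β * β + (α * y⁻ + α * y⁻) + (β * y⁺ + β * y⁺)) -
      (α * y⁺ + α * y⁺ + (β * y⁻ + β * y⁻) + (α * β + α * β)) := by
    linear_combination 2 * (α - β) * posPart_sub_negPart y
  rw [h3, h2]
  ring

end Averaging

/-! ### Natural elements, partitions of the unit and products under independence -/

section Natural

open Set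

variable {E : Type*} [ConditionallyCompleteLattice E] [AddCommGroup E] [IsOrderedAddMonoid E]
  [Module ℝ E] [IsOrderedModule ℝ E]
variable {U : Type*} [ConditionallyCompleteLattice U] [CommRing U] [IsOrderedRing U]
  [Algebra ℝ U] [IsOrderedModule ℝ U]
variable {e : E} {T : E →ₗ[ℝ] E} {ι : E →ₗ[ℝ] U}

namespace IsFAlgebra

theorem isLUB_mul_range (hU : IsFAlgebra U) {a b : ℕ → U} {A B : U} (ha : IsLUB (range a) A)
    (hb : IsLUB (range b) B) (ma : Monotone a) (mb : Monotone b) (a0 : ∀ n, 0 ≤ a n)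
    (b0 : ∀ n, 0 ≤ b n) : IsLUB (range fun n => a n * b n) (A * B) := by
  have hA : 0 ≤ A := (a0 0).trans (ha.1 ⟨0, rfl⟩)
  have hB : 0 ≤ B := (b0 0).trans (hb.1 ⟨0, rfl⟩)
  constructor
  · rintro _ ⟨n, rfl⟩
    exact mul_le_mul (ha.1 ⟨n, rfl⟩) (hb.1 ⟨n, rfl⟩) (b0 n) hA
  · intro w hw
    rw [mul_comm]
    refine (hU.isLUB_mul ha hB).2 ?_
    rintro _ ⟨i, rfl⟩
    dsimp only
    rw [mul_comm]
    refine (hU.isLUB_mul hb (a0 i)).2 ?_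
    rintro _ ⟨j, rfl⟩
    exact (mul_le_mul (ma (le_max_left i j)) (mb (le_max_right i j)) (b0 j) (a0 _)).trans
      (hw ⟨max i j, rfl⟩)

theorem isLUB_prod_range (hU : IsFAlgebra U) {κ : Type*} (s : Finset κ) {a : κ → ℕ → U}
    {A : κ → U} (ha : ∀ i ∈ s, IsLUB (range (a i)) (A i)) (ma : ∀ i ∈ s, Monotone (a i))
    (a0 : ∀ i ∈ s, ∀ n, 0 ≤ a i n) :
    IsLUB (range fun n => ∏ i ∈ s, a i n) (∏ i ∈ s, A i) ∧ Monotone fun n => ∏ i ∈ s, a i n := by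
  classical
  induction s using Finset.induction_on with
  | empty => simpa using monotone_const
  | insert k s hk ih =>
    simp only [Finset.prod_insert hk]
    have ih' := ih (fun i hi => ha i (Finset.mem_insert_of_mem hi))
      (fun i hi => ma i (Finset.mem_insert_of_mem hi))
      fun i hi => a0 i (Finset.mem_insert_of_mem hi)
    have hk' := Finset.mem_insert_self k s
    have h0 : ∀ n, 0 ≤ ∏ i ∈ s, a i n := fun n =>
      Finset.prod_nonneg fun i hi => a0 i (Finset.mem_insert_of_mem hi) n
    refine ⟨hU.isLUB_mul_range (ha k hk') ih'.1 (ma k hk') ih'.2 (a0 k hk') h0, fun m n h => ?_⟩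
    exact mul_le_mul (ma k hk' h) (ih'.2 h) (h0 m) (a0 k hk' n)

theorem isLUB_pow_range (hU : IsFAlgebra U) {a : ℕ → U} {A : U} (ha : IsLUB (range a) A)
    (ma : Monotone a) (a0 : ∀ n, 0 ≤ a n) (j : ℕ) :
    IsLUB (range fun n => a n ^ j) (A ^ j) := by
  simpa using (hU.isLUB_prod_range (Finset.range j) (a := fun _ => a) (A := fun _ => A)
    (fun _ _ => ha) (fun _ _ => ma) fun _ _ => a0).1

end IsFAlgebra

/-- A countable partition of the unit into components. -/
structure IsPartition (q : ℕ → U) : Prop where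
  idem : ∀ k, IsIdempotentElem (q k)
  orth : ∀ j k, j ≠ k → q j * q k = 0
  isLUB : IsLUB (range fun m => ∑ k ∈ Finset.range m, q k) 1

namespace IsPartition

variable {q : ℕ → U}

theorem nonneg (hq : IsPartition q) (hU : IsFAlgebra U) (k : ℕ) : 0 ≤ q k :=
  hU.idem_nonneg (hq.idem k)

theorem le_of_local (hq : IsPartition q) (hU : IsFAlgebra U) {u v : U}
    (h : ∀ k, q k * u ≤ q k * v) : u ≤ v := by
  have := hU.mul_le_mul_of_local hq.isLUB (fun m => Finset.sum_nonneg fun k _ => hq.nonneg hU k)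
    (u := u) (v := v) fun m => by
      rw [Finset.sum_mul, Finset.sum_mul]
      exact Finset.sum_le_sum fun k _ => h k
  simpa using this

theorem eq_of_local (hq : IsPartition q) (hU : IsFAlgebra U) {u v : U}
    (h : ∀ k, q k * u = q k * v) : u = v :=
  le_antisymm (hq.le_of_local hU fun k => (h k).le) (hq.le_of_local hU fun k => (h k).ge)

theorem isLUB_mul (hq : IsPartition q) (hU : IsFAlgebra U) {y : U} (hy : 0 ≤ y) :
    IsLUB (range fun m => ∑ k ∈ Finset.range m, q k * y) y := by
  have := hU.isLUB_mul hq.isLUB hy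
  simpa only [mul_comm y, Finset.sum_mul, one_mul] using this

theorem monotone_sum {G : Type*} [AddCommGroup G] [PartialOrder G] [IsOrderedAddMonoid G]
    {a : ℕ → G} (ha : ∀ k, 0 ≤ a k) : Monotone fun m => ∑ k ∈ Finset.range m, a k :=
  fun _ _ h => Finset.sum_le_sum_of_subset_of_nonneg (Finset.range_subset_range.2 h)
    fun k _ _ => ha k

theorem mul_sum (hq : IsPartition q) (a : ℕ → U) (k m : ℕ) :
    q k * ∑ j ∈ Finset.range m, q j * a j = if k < m then q k * a k else 0 := by
  rw [Finset.mul_sum]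
  split_ifs with h
  · rw [Finset.sum_eq_single_of_mem k (Finset.mem_range.2 h), ← mul_assoc, (hq.idem k).eq]
    intro j _ hj
    rw [← mul_assoc, hq.orth k j hj.symm, zero_mul]
  · refine Finset.sum_eq_zero fun j hj => ?_
    rw [← mul_assoc, hq.orth k j fun hkj => h (hkj ▸ Finset.mem_range.1 hj), zero_mul]

/-- Inequalities may be checked on the common refinement of finitely many partitions. -/
theorem le_of_local_prod {q : ℕ → ℕ → U} (hq : ∀ i, IsPartition (q i)) (hU : IsFAlgebra U) (n : ℕ) :
    ∀ {c u v : U}, (∀ k : ℕ → ℕ, c * (∏ i ∈ Finset.range n, q i (k i)) * u ≤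
      c * (∏ i ∈ Finset.range n, q i (k i)) * v) → c * u ≤ c * v := by
  induction n with
  | zero => intro c u v h; simpa using h 0
  | succ n ih =>
    intro c u v h
    refine (hq n).le_of_local hU fun j => ?_
    rw [← mul_assoc, ← mul_assoc]
    refine ih fun k => ?_
    -- The last partition gets index `j`; the choices for the earlier ones are untouched.
    have h1 := h (Function.update k n j)
    have h2 : ∏ i ∈ Finset.range n, q i (Function.update k n j i) =
        ∏ i ∈ Finset.range n, q i (k i) := Finset.prod_congr rfl fun i hi => by
      rw [Function.update_of_ne (Finset.mem_range.1 hi).ne]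
    rw [Finset.prod_range_succ, Function.update_self, h2] at h1
    convert h1 using 1 <;> ring

end IsPartition

theorem IsFAlgebra.projEq_natCast_mul (hU : IsFAlgebra U) (x : U) (k : ℕ) :
    projEq x (k : U) 1 * x = (k : ℝ) • projEq x (k : U) 1 := by
  rw [hU.projEq_mul, Nat.cast_smul_eq_nsmul, nsmul_eq_mul, mul_comm]

theorem mul_natCast_eq_smul (c : U) (k : ℕ) : c * k = (k : ℝ) • c := by
  rw [Nat.cast_smul_eq_nsmul, nsmul_eq_mul, mul_comm]

theorem IsFAlgebra.projEq_orth (hU : IsFAlgebra U) (x : U) {j k : ℕ} (h : j ≠ k) :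
    projEq x (j : U) 1 * projEq x (k : U) 1 = 0 :=
  hU.mul_projEq_of_ne (hU.idem_nonneg (hU.projEq_idem x j)) (hU.projEq_natCast_mul x j)
    (mul_natCast_eq_smul _ _) (Nat.cast_injective.ne h)

theorem IsFAlgebra.sum_le_one (hU : IsFAlgebra U) {q : ℕ → U} (hq : ∀ k, IsIdempotentElem (q k))
    (ho : ∀ j k, j ≠ k → q j * q k = 0) (m : ℕ) : ∑ k ∈ Finset.range m, q k ≤ 1 := by
  refine hU.idem_le_one ?_
  induction m with
  | zero => simp [IsIdempotentElem]
  | succ m ih =>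
    have h : (∑ k ∈ Finset.range m, q k) * q m = 0 := by
      rw [Finset.sum_mul]
      exact Finset.sum_eq_zero fun k hk => ho k m (Finset.mem_range.1 hk).ne
    rw [Finset.sum_range_succ, IsIdempotentElem]
    linear_combination ih.eq + (hq m).eq + 2 * h

variable (hT : IsConditionalRieszTriple e T) (hι : IsUniversalCompletion e ι)
include hT hι

theorem hasExp_of_idem {p : U} (hp : IsIdempotentElem p) : HasExp T ι p (condExp T ι p) :=
  hasExp_of_le_natCast hT hι (n := 1) (hι.isFAlgebra.idem_nonneg hp)
    (by simpa using hι.isFAlgebra.idem_le_one hp)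

theorem hasExp_mass (x : U) (k : ℕ) : HasExp T ι (projEq x (k : U) 1) (mass T ι x k) :=
  hasExp_of_idem hT hι (hι.isFAlgebra.projEq_idem x k)

theorem mass_nonneg (x : U) (k : ℕ) : 0 ≤ mass T ι x k := (hasExp_mass hT hι x k).nonneg_val

theorem eq_zero_of_hasExp_zero {u : U} (hu : HasExp T ι u 0) : u = 0 := by
  by_contra h
  obtain ⟨y, hy0, hy⟩ := hι.order_dense u (lt_of_le_of_ne hu.1 (Ne.symm h))
  have h1 : ι (T y) ≤ ι 0 := by
    rw [map_zero]; exact hu.2.1 ⟨y, hy0.le, hy, rfl⟩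
  exact absurd (hT.strictly_pos y hy0) (not_lt_of_ge (hι.le_iff.1 h1))

/-- Monotone convergence gives the sum `s` of the components expectation 1, so `1 - s ≥ 0` has
expectation 0 and vanishes by strict positivity. -/
theorem IsNatural.isPartition {x : U} (hx : IsNatural T ι x) :
    IsPartition fun k : ℕ => projEq x (k : U) 1 := by
  have hU := hι.isFAlgebra
  have hi : ∀ k : ℕ, IsIdempotentElem (projEq x (k : U) 1) := fun k => hU.projEq_idem x k
  have ho : ∀ j k : ℕ, j ≠ k → projEq x (j : U) 1 * projEq x (k : U) 1 = 0 :=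
    fun j k h => hU.projEq_orth x h
  have hle := hU.sum_le_one hi ho
  refine ⟨hi, ho, ?_⟩
  have hs := isLUB_ciSup (f := fun m => ∑ k ∈ Finset.range m, projEq x (k : U) 1)
    ⟨1, by rintro _ ⟨m, rfl⟩; exact hle m⟩
  set s := ⨆ m, ∑ k ∈ Finset.range m, projEq x (k : U) 1
  have hs1 : s ≤ 1 := hs.2 (by rintro _ ⟨m, rfl⟩; exact hle m)
  have h1 : HasExp T ι s 1 := (hasExp_iff_of_monotone hT hι
    (IsPartition.monotone_sum fun k => hU.idem_nonneg (hi k))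
    (fun m => HasExp.sum hT hι _ fun k _ => hasExp_mass hT hι x k) hs).2 hx
  obtain ⟨b, hb⟩ := HasExp.exists_of_le (sub_nonneg.2 hs1) (hasExp_one hT hι)
    (sub_le_self 1 h1.1)
  have h2 := h1.add hT hι hb
  rw [add_sub_cancel] at h2
  have h3 : b = 0 := by simpa using h2.unique (hasExp_one hT hι)
  rw [h3] at hb
  have h4 := eq_zero_of_hasExp_zero hT hι hb
  rwa [← sub_eq_zero.1 h4] at hs

theorem IsNatural.nonneg {x : U} (hx : IsNatural T ι x) : 0 ≤ x := by
  refine (hx.isPartition hT hι).le_of_local hι.isFAlgebra fun k => ?_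
  rw [mul_zero, hι.isFAlgebra.projEq_natCast_mul]
  exact smul_nonneg (Nat.cast_nonneg k) ((hx.isPartition hT hι).nonneg hι.isFAlgebra k)

/-- The expectation of a function of a natural element. -/
theorem IsNatural.hasExp_iff {x : U} (hx : IsNatural T ι x) {φ : ℕ → ℝ} (hφ : ∀ k, 0 ≤ φ k)
    {y A : U} (hy : 0 ≤ y) (h : ∀ k : ℕ, projEq x (k : U) 1 * y = φ k • projEq x (k : U) 1) :
    HasExp T ι y A ↔ IsLUB (range fun m => ∑ k ∈ Finset.range m, φ k • mass T ι x k) A := by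
  have hp := hx.isPartition hT hι
  have h1 := hp.isLUB_mul hι.isFAlgebra hy
  simp only [h] at h1
  exact hasExp_iff_of_monotone hT hι
    (IsPartition.monotone_sum fun k => smul_nonneg (hφ k) (hp.nonneg hι.isFAlgebra k))
    (fun m => HasExp.sum hT hι _ fun k _ => (hasExp_mass hT hι x k).smul hT hι (hφ k)) h1

/-- Shows that the distribution function determines the masses. It is checked on each component `x =
k`; the subtraction is real, so `n = 0` uses the value at `-1`. -/
theorem IsNatural.mass_eq_sub {x : U} (hx : IsNatural T ι x) (n : ℕ) :
    mass T ι x n = distFun T ι x n - distFun T ι x ((n : ℝ) - 1) := by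
  have hU := hι.isFAlgebra
  have hp := hx.isPartition hT hι
  have key : projEq x (n : U) 1 =
      projLe x (algebraMap ℝ U n) 1 - projLe x (algebraMap ℝ U ((n : ℝ) - 1)) 1 := by
    have ht : ∀ (c : U) (t : ℝ), c * algebraMap ℝ U t = t • c := fun c t => by
      rw [Algebra.smul_def, mul_comm]
    refine hp.eq_of_local hU fun k => ?_
    have hk := hU.projEq_natCast_mul x k
    have hk0 := hp.nonneg hU k
    have hle : ∀ t : ℝ, (k : ℝ) ≤ t →
        projEq x (k : U) 1 * projLe x (algebraMap ℝ U t) 1 = projEq x (k : U) 1 := fun t h => by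
      refine hU.mul_projLe_of_le hk0 ?_
      rw [hk, ht]
      exact smul_le_smul_of_nonneg_right h hk0
    have hlt : ∀ t : ℝ, t < k →
        projEq x (k : U) 1 * projLe x (algebraMap ℝ U t) 1 = 0 := fun t h =>
      hU.mul_projLe_of_lt hk0 hk (ht _ t) h
    rw [mul_sub]
    rcases lt_trichotomy k n with h | rfl | h
    · have h1 : (k : ℝ) ≤ (n : ℝ) - 1 := by
        have : ((k + 1 : ℕ) : ℝ) ≤ n := Nat.cast_le.2 h
        push_cast at this; linarith
      rw [hle _ h1, hle _ (by linarith), hU.projEq_orth x h.ne, sub_self]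
    · rw [hle _ le_rfl, hlt _ (by linarith), (hp.idem k).eq, sub_zero]
    · have h1 : (n : ℝ) < k := Nat.cast_lt.2 h
      rw [hlt _ h1, hlt _ (by linarith), hU.projEq_orth x h.ne', sub_self]
  rw [mass, key]
  exact (hasExp_of_idem hT hι (hU.projLe_idem x _)).condExp_sub hT hι
    (hasExp_of_idem hT hι (hU.projLe_idem x _))

theorem mass_eq_of_sameTDist {x y : U} (hx : IsNatural T ι x) (hy : IsNatural T ι y)
    (h : SameTDist T ι x y) (n : ℕ) : mass T ι x n = mass T ι y n := by
  rw [hx.mass_eq_sub hT hι, hy.mass_eq_sub hT hι, h, h]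

omit hT in
theorem IsClosedRieszSubspace.projEq_mem {F : Submodule ℝ U} (hF : IsClosedRieszSubspace F)
    {x : U} (hx : x ∈ F) (h1 : (1 : U) ∈ F) (k : ℕ) : projEq x (k : U) 1 ∈ F := by
  have habs : |x - k| ∈ F := by
    have hk : x - k ∈ F := sub_mem hx (by rw [← nsmul_one]; exact nsmul_mem h1 k)
    exact hF.sup_mem _ hk _ (neg_mem hk)
  have hl := IsFAlgebra.isLUB_bandProj_one |x - k|
  rw [abs_abs] at hl
  refine sub_mem h1 (hF.closed _ ?_ (range_nonempty _) _ hl)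
  rintro _ ⟨n, rfl⟩
  have := neg_mem (hF.sup_mem _ (neg_mem h1) _ (neg_mem (nsmul_mem habs n)))
  rwa [← neg_inf, neg_neg] at this

theorem projEq_mem_closedRieszSpan (x : U) (k : ℕ) :
    projEq x (k : U) 1 ∈ closedRieszSpan (insert x (ι '' range T)) := by
  intro F hF hA
  refine hF.projEq_mem hι (hA (mem_insert _ _)) (hA (mem_insert_of_mem _ ?_)) k
  exact ⟨e, ⟨e, hT.map_unit⟩, hι.map_unit⟩

omit hT hι in
theorem Averages.mul {f g : U} (hf : Averages T ι f) (hg : Averages T ι g) :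
    Averages T ι (f * g) := by
  refine ⟨mul_nonneg hf.1 hg.1, fun u a hu => ?_⟩
  rw [mul_assoc, mul_assoc]
  exact hf.2 _ _ (hg.2 _ _ hu)

omit hT hι in
theorem Averages.one : Averages T ι (1 : U) :=
  ⟨zero_le_one, fun u a hu => by simpa using hu⟩

theorem isBandProjection_mulLeft {p : U} (hp : IsIdempotentElem p) :
    IsBandProjection (LinearMap.mulLeft ℝ p) := by
  have hU := hι.isFAlgebra
  refine ⟨fun x => ?_, fun x hx => ?_, fun x hx => ?_⟩ <;>
    simp only [LinearMap.mulLeft_apply]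
  · rw [← mul_assoc, hp.eq]
  · exact mul_nonneg (hU.idem_nonneg hp) hx
  · exact mul_le_of_le_one_left hx (hU.idem_le_one hp)

/-- Independence is applied to multiplication by the components. The nested expectations become a
product of masses, because each inner value is a product of masses and can be taken out. -/
theorem IsTIndependent.hasExp_prod_projEq {I : Type*} {f : I → U} (hf : IsTIndependent T ι f)
    (k : I → ℕ) (s : Finset I) : HasExp T ι (∏ i ∈ s, projEq (f i) (k i : U) 1)
      (∏ i ∈ s, mass T ι (f i) (k i)) := by
  have hU := hι.isFAlgebra
  have hid : ∀ i, IsIdempotentElem (projEq (f i) (k i : U) 1) := fun i => hU.projEq_idem _ _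
  have h := hf (fun i => LinearMap.mulLeft ℝ (projEq (f i) (k i : U) 1))
    (fun i => isBandProjection_mulLeft hT hι (hid i))
    (fun i => by
      simpa only [LinearMap.mulLeft_apply, mul_one] using projEq_mem_closedRieszSpan hT hι _ _)
    s.toList s.nodup_toList
  simp only [LinearMap.mulLeft_apply] at h
  have h1 : ∀ l : List I, l.foldr (fun i z => projEq (f i) (k i : U) 1 * z) 1 =
      (l.map fun i => projEq (f i) (k i : U) 1).prod := fun l => by
    induction l with
    | nil => rfl
    | cons i l ih => simp [ih]
  have h2 : ∀ l : List I, l.foldr (fun i z => condExp T ι (projEq (f i) (k i : U) 1 * z)) 1 =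
      (l.map fun i => mass T ι (f i) (k i)).prod ∧
      Averages T ι (l.map fun i => mass T ι (f i) (k i)).prod := fun l => by
    induction l with
    | nil => exact ⟨rfl, Averages.one⟩
    | cons i l ih =>
      have hi := hasExp_mass hT hι (f i) (k i)
      rw [List.foldr_cons, ih.1, List.map_cons, List.prod_cons]
      have h3 := ih.2.2 _ _ hi
      rw [mul_comm, mul_comm _ (mass _ _ _ _)] at h3
      exact ⟨h3.condExp_eq hT hι, (hi.averages hT hι).mul ih.2⟩
  rw [h1, (h2 _).1, Finset.prod_map_toList, Finset.prod_map_toList] at h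
  rw [← h]
  exact hasExp_of_idem hT hι (Finset.prod_induction _ IsIdempotentElem
    (fun a b ha hb => ha.mul hb) IsIdempotentElem.one fun i _ => hid i)

/-- Functions of the members of a `T`-independent family of natural elements are uncorrelated. -/
theorem IsTIndependent.hasExp_prod {I : Type*} {f : I → U} (hf : IsTIndependent T ι f)
    (hn : ∀ i, IsNatural T ι (f i)) (s : Finset I) {φ : I → ℕ → ℝ} (hφ : ∀ i k, 0 ≤ φ i k)
    {y a : I → U} (hya : ∀ i ∈ s, HasExp T ι (y i) (a i))
    (hy : ∀ i ∈ s, ∀ k : ℕ, projEq (f i) (k : U) 1 * y i = φ i k • projEq (f i) (k : U) 1) :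
    HasExp T ι (∏ i ∈ s, y i) (∏ i ∈ s, a i) := by
  classical
  have hU := hι.isFAlgebra
  have hp := fun i => (hn i).isPartition hT hι
  have h1 := hU.isLUB_prod_range s
    (a := fun i m => ∑ k ∈ Finset.range m, φ i k • projEq (f i) (k : U) 1) (A := y)
    (fun i hi => by
      have := (hp i).isLUB_mul hU (hya i hi).1
      simpa only [hy i hi] using this)
    (fun i _ => IsPartition.monotone_sum fun k => smul_nonneg (hφ i k) ((hp i).nonneg hU k))
    fun i _ n => Finset.sum_nonneg fun k _ => smul_nonneg (hφ i k) ((hp i).nonneg hU k)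
  have h2 := hU.isLUB_prod_range s
    (a := fun i m => ∑ k ∈ Finset.range m, φ i k • mass T ι (f i) k) (A := a)
    (fun i hi => ((hn i).hasExp_iff hT hι (hφ i) (hya i hi).1 (hy i hi)).1 (hya i hi))
    (fun i _ => IsPartition.monotone_sum fun k => smul_nonneg (hφ i k) (mass_nonneg hT hι _ k))
    fun i _ n => Finset.sum_nonneg fun k _ => smul_nonneg (hφ i k) (mass_nonneg hT hι _ k)
  refine (hasExp_iff_of_monotone hT hι h1.2 (fun m => ?_) h1.1).2 h2.1
  -- The product of partial sums becomes a sum over choices of one level per index; a choice on `s`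
  -- is extended by 0 to all of `I`.
  rw [Finset.prod_sum, Finset.prod_sum]
  refine HasExp.sum hT hι _ fun p _ => ?_
  set k : I → ℕ := fun i => if h : i ∈ s then p i h else 0 with hk
  have hk' : ∀ i : s, p i.1 i.2 = k i.1 := fun i => by simp [hk, i.2]
  simp only [hk']
  rw [Finset.prod_attach s fun i => φ i (k i) • projEq (f i) (k i : U) 1,
    Finset.prod_attach s fun i => φ i (k i) • mass T ι (f i) (k i),
    Finset.prod_smul, Finset.prod_smul]
  exact (hf.hasExp_prod_projEq hT hι k s).smul hT hι (Finset.prod_nonneg fun i _ => hφ i (k i))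

end Natural

/-! ### The random sum: existence, naturality, first and second moments -/

section RandomSumMoments

open Set

variable {E : Type*} [ConditionallyCompleteLattice E] [AddCommGroup E] [IsOrderedAddMonoid E]
  [Module ℝ E] [IsOrderedModule ℝ E]
variable {U : Type*} [ConditionallyCompleteLattice U] [CommRing U] [IsOrderedRing U]
  [Algebra ℝ U] [IsOrderedModule ℝ U]
variable {e : E} {T : E →ₗ[ℝ] E} {ι : E →ₗ[ℝ] U} {N : U} {x : ℕ → U}

/-- The term `n = 0` may be included because `S₀` is an empty sum. -/
theorem randomSumPartial_eq (hU : IsFAlgebra U) (N : U) (x : ℕ → U) (m : ℕ) :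
    randomSumPartial N x m =
      ∑ n ∈ Finset.range (m + 1), projEq N (n : U) 1 * ∑ i ∈ Finset.range n, x i := by
  rw [randomSumPartial, Finset.range_eq_Ico, Finset.sum_eq_sum_Ico_succ_bot (Nat.succ_pos m)]
  simp only [Finset.sum_empty, mul_zero, zero_add, Finset.range_zero,
    hU.projEq_eq_mul N _ (∑ i ∈ Finset.range _, x i)]
  rfl

variable (hT : IsConditionalRieszTriple e T) (hι : IsUniversalCompletion e ι)
include hT hι

/-- The random sum exists, by lateral completeness. -/
theorem randomSum_spec (hN : IsNatural T ι N) (hx : ∀ i, IsNatural T ι (x i)) :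
    IsLUB (range (randomSumPartial N x)) (randomSum N x) ∧ 0 ≤ randomSum N x ∧
      ∀ n : ℕ, projEq N (n : U) 1 * randomSum N x =
        projEq N (n : U) 1 * ∑ i ∈ Finset.range n, x i := by
  have hU := hι.isFAlgebra
  have hp := hN.isPartition hT hι
  set S : ℕ → U := fun n => ∑ i ∈ Finset.range n, x i with hS
  have hS0 : ∀ n, 0 ≤ S n := fun n => Finset.sum_nonneg fun i _ => (hx i).nonneg hT hι
  have h0 : ∀ n : ℕ, 0 ≤ projEq N (n : U) 1 * S n := fun n => mul_nonneg (hp.nonneg hU n) (hS0 n)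
  obtain ⟨B, hB⟩ := hι.laterally_complete (range fun n : ℕ => projEq N (n : U) 1 * S n)
    (by rintro _ ⟨n, rfl⟩; exact h0 n)
    (by
      rintro _ ⟨m, rfl⟩ _ ⟨n, rfl⟩ hne
      have hmn : m ≠ n := fun h => hne (by rw [h])
      refine hU.inf_eq_zero_of_mul (h0 m) (h0 n) ?_
      have := hp.orth m n hmn
      dsimp only
      linear_combination S m * S n * this)
  have hpart : ∀ m, randomSumPartial N x m =
      ∑ n ∈ Finset.range (m + 1), projEq N (n : U) 1 * S n := randomSumPartial_eq hU N x
  have hB0 : 0 ≤ B := (h0 0).trans (hB ⟨0, rfl⟩)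
  have hb : BddAbove (range (randomSumPartial N x)) := by
    refine ⟨B, ?_⟩
    rintro _ ⟨m, rfl⟩
    rw [hpart]
    -- Idempotence localizes the bound: each term is at most its own component times `B`, and the
    -- components sum to at most 1.
    calc ∑ n ∈ Finset.range (m + 1), projEq N (n : U) 1 * S n
        ≤ ∑ n ∈ Finset.range (m + 1), projEq N (n : U) 1 * B :=
          Finset.sum_le_sum fun n _ => by
            have h1 := mul_le_mul_of_nonneg_left (hB ⟨n, rfl⟩) (hp.nonneg hU n)
            dsimp only at h1
            rwa [← mul_assoc, (hp.idem n).eq] at h1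
      _ ≤ 1 * B := by
          rw [← Finset.sum_mul]
          exact mul_le_mul_of_nonneg_right (hU.sum_le_one hp.idem hp.orth _) hB0
      _ = B := one_mul B
  have hl : IsLUB (range (randomSumPartial N x)) (randomSum N x) := isLUB_ciSup hb
  refine ⟨hl, ?_, fun n => ?_⟩
  · refine le_trans ?_ (hl.1 ⟨0, rfl⟩)
    rw [hpart]
    exact Finset.sum_nonneg fun n _ => h0 n
  · have h1 := hU.isLUB_mul hl (hp.nonneg hU n)
    have h2 : ∀ m, projEq N (n : U) 1 * randomSumPartial N x m =
        if n < m + 1 then projEq N (n : U) 1 * S n else 0 := fun m => by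
      rw [hpart]; exact hp.mul_sum S n (m + 1)
    simp only [h2] at h1
    refine h1.unique ⟨?_, fun w hw => hw ⟨n, by simp [hS]⟩⟩
    rintro _ ⟨m, rfl⟩
    dsimp only
    split_ifs
    · exact le_rfl
    · exact h0 n

/-- The value of the random sum on a component on which all variables are constant. -/
theorem mul_randomSum_eq {R : U}
    (hR : ∀ n : ℕ, projEq N (n : U) 1 * R = projEq N (n : U) 1 * ∑ i ∈ Finset.range n, x i)
    (n : ℕ) (k : ℕ → ℕ) :
    projEq N (n : U) 1 * (∏ i ∈ Finset.range n, projEq (x i) (k i : U) 1) * R =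
      ((∑ i ∈ Finset.range n, k i : ℕ) : ℝ) •
        (projEq N (n : U) 1 * ∏ i ∈ Finset.range n, projEq (x i) (k i : U) 1) := by
  set q := ∏ i ∈ Finset.range n, projEq (x i) (k i : U) 1 with hq
  have h1 : ∀ i ∈ Finset.range n, q * x i = (k i : ℝ) • q := fun i hi => by
    rw [hq, ← Finset.prod_erase_mul _ _ hi, mul_assoc, hι.isFAlgebra.projEq_natCast_mul,
      mul_smul_comm]
  have h2 : q * ∑ i ∈ Finset.range n, x i = ((∑ i ∈ Finset.range n, k i : ℕ) : ℝ) • q := by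
    rw [Finset.mul_sum, Finset.sum_congr rfl h1, ← Finset.sum_smul, Nat.cast_sum]
  rw [mul_right_comm, hR, mul_right_comm, mul_assoc, h2, mul_smul_comm]

theorem prod_projEq_nonneg (n : ℕ) (k : ℕ → ℕ) :
    0 ≤ projEq N (n : U) 1 * ∏ i ∈ Finset.range n, projEq (x i) (k i : U) 1 :=
  mul_nonneg (hι.isFAlgebra.idem_nonneg (hι.isFAlgebra.projEq_idem _ _))
    (Finset.prod_nonneg fun _ _ => hι.isFAlgebra.idem_nonneg (hι.isFAlgebra.projEq_idem _ _))

/-- Inequalities may be checked on components on which `N` and the summands are constant. -/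
theorem le_of_local_randomSum (hN : IsNatural T ι N) (hx : ∀ i, IsNatural T ι (x i)) {u v : U}
    (h : ∀ (n : ℕ) (k : ℕ → ℕ),
      projEq N (n : U) 1 * (∏ i ∈ Finset.range n, projEq (x i) (k i : U) 1) * u ≤
      projEq N (n : U) 1 * (∏ i ∈ Finset.range n, projEq (x i) (k i : U) 1) * v) : u ≤ v :=
  (hN.isPartition hT hι).le_of_local hι.isFAlgebra fun n =>
    IsPartition.le_of_local_prod (fun i => (hx i).isPartition hT hι) hι.isFAlgebra n
      fun k => h n k

/-- Each component of the common refinement lies in `S_N = K`, where `K` is the sum of the values of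
the summands there. Hence the level components of `S_N` have supremum 1, and so do the sums of their
expectations. -/
theorem isNatural_randomSum (hN : IsNatural T ι N) (hx : ∀ i, IsNatural T ι (x i)) :
    IsNatural T ι (randomSum N x) := by
  have hU := hι.isFAlgebra
  obtain ⟨-, -, hR⟩ := randomSum_spec hT hι hN hx
  set R := randomSum N x
  have hi : ∀ k : ℕ, IsIdempotentElem (projEq R (k : U) 1) := fun k => hU.projEq_idem R k
  have h0 := fun k => hU.idem_nonneg (hi k)
  have hle := hU.sum_le_one hi fun j k h => hU.projEq_orth R h
  have hs := isLUB_ciSup (f := fun m => ∑ k ∈ Finset.range m, projEq R (k : U) 1)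
    ⟨1, by rintro _ ⟨m, rfl⟩; exact hle m⟩
  set s := ⨆ m, ∑ k ∈ Finset.range m, projEq R (k : U) 1
  have hs1 : s = 1 := by
    refine le_antisymm (hs.2 (by rintro _ ⟨m, rfl⟩; exact hle m)) ?_
    refine le_of_local_randomSum hT hι hN hx fun n k => ?_
    have hc := mul_randomSum_eq hT hι hR n k
    have hc0 : 0 ≤ projEq N (n : U) 1 * ∏ i ∈ Finset.range n, projEq (x i) (k i : U) 1 :=
      prod_projEq_nonneg hT hι n k
    set c := projEq N (n : U) 1 * ∏ i ∈ Finset.range n, projEq (x i) (k i : U) 1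
    set K := ∑ i ∈ Finset.range n, k i
    have h1 : c * projEq R (K : U) 1 = c :=
      hU.mul_projEq_of_eq hc0 (hc.trans (mul_natCast_eq_smul c K).symm)
    have h2 : projEq R (K : U) 1 ≤ s := (Finset.single_le_sum (f := fun k : ℕ =>
      projEq R (k : U) 1) (fun k _ => h0 k) (Finset.self_mem_range_succ K)).trans
        (hs.1 ⟨K + 1, rfl⟩)
    calc c * 1 = c * projEq R (K : U) 1 := by rw [mul_one, h1]
      _ ≤ c * s := mul_le_mul_of_nonneg_left h2 hc0
  rw [hs1] at hs
  exact (hasExp_iff_of_monotone hT hι (IsPartition.monotone_sum h0)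
    (fun m => HasExp.sum hT hι _ fun k _ => hasExp_mass hT hι R k) hs).1 (hasExp_one hT hι)

theorem IsNatural.hasExp_iff_sum (hN : IsNatural T ι N) {y A : U} {b : ℕ → U} (hy : 0 ≤ y)
    (hb : ∀ n : ℕ, HasExp T ι (projEq N (n : U) 1 * y) (b n)) :
    HasExp T ι y A ↔ IsLUB (range fun m => ∑ n ∈ Finset.range m, b n) A :=
  hasExp_iff_of_monotone hT hι (IsPartition.monotone_sum fun n => (hb n).1)
    (fun _ => HasExp.sum hT hι _ fun n _ => hb n)
    ((hN.isPartition hT hι).isLUB_mul hι.isFAlgebra hy)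

theorem hasExp_of_sameTDist {x y u v a : U} (hx : IsNatural T ι x) (hy : IsNatural T ι y)
    (h : SameTDist T ι x y) {φ : ℕ → ℝ} (hφ : ∀ k, 0 ≤ φ k) (hu0 : 0 ≤ u)
    (hu : ∀ k : ℕ, projEq x (k : U) 1 * u = φ k • projEq x (k : U) 1)
    (hv : ∀ k : ℕ, projEq y (k : U) 1 * v = φ k • projEq y (k : U) 1)
    (ha : HasExp T ι v a) : HasExp T ι u a := by
  rw [hx.hasExp_iff hT hι hφ hu0 hu]
  simp only [mass_eq_of_sameTDist hT hι hx hy h]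
  exact (hy.hasExp_iff hT hι hφ ha.1 hv).1 ha

theorem projEq_natCast_mul_sq (x : U) (k : ℕ) :
    projEq x (k : U) 1 * x ^ 2 = ((k : ℝ) ^ 2) • projEq x (k : U) 1 := by
  rw [sq, ← mul_assoc, hι.isFAlgebra.projEq_natCast_mul, smul_mul_assoc,
    hι.isFAlgebra.projEq_natCast_mul, smul_smul, sq]

theorem IsNatural.le_sq {x : U} (hx : IsNatural T ι x) : x ≤ x ^ 2 := by
  refine (hx.isPartition hT hι).le_of_local hι.isFAlgebra fun k => ?_
  rw [hι.isFAlgebra.projEq_natCast_mul, projEq_natCast_mul_sq hT hι]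
  refine smul_le_smul_of_nonneg_right ?_ ((hx.isPartition hT hι).nonneg hι.isFAlgebra k)
  exact_mod_cast Nat.le_self_pow two_ne_zero k

theorem projEq_mul_projEq (x : U) (n k : ℕ) :
    projEq x (k : U) 1 * projEq x (n : U) 1 =
      (if k = n then (1 : ℝ) else 0) • projEq x (k : U) 1 := by
  split_ifs with h
  · rw [h, (hι.isFAlgebra.projEq_idem x n).eq, one_smul]
  · rw [hι.isFAlgebra.projEq_orth x h, zero_smul]

/-- Expectations of `1_{N = n} y₀ ⋯ yₙ₋₁`, where `yᵢ` is a function of `xᵢ`. -/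
theorem IsTIndependent.hasExp_mul_prod
    (hind : IsTIndependent T ι (fun o : Option ℕ => o.elim N x)) (hN : IsNatural T ι N)
    (hx : ∀ i, IsNatural T ι (x i)) (n : ℕ) (s : Finset ℕ) {φ : ℕ → ℕ → ℝ}
    (hφ : ∀ i k, 0 ≤ φ i k) {y a : ℕ → U} (hya : ∀ i ∈ s, HasExp T ι (y i) (a i))
    (hy : ∀ i ∈ s, ∀ k : ℕ, projEq (x i) (k : U) 1 * y i = φ i k • projEq (x i) (k : U) 1) :
    HasExp T ι (projEq N (n : U) 1 * ∏ i ∈ s, y i) (mass T ι N n * ∏ i ∈ s, a i) := by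
  have h := hind.hasExp_prod hT hι (by rintro (_ | i); exacts [hN, hx i])
    -- The component of `N = n` is itself a function of `N`, namely the indicator of `{n}`.
    (Finset.insertNone s) (φ := fun o k => o.elim (if k = n then 1 else 0) fun i => φ i k)
    (by
      rintro (_ | i) k
      · simp only [Option.elim]; split_ifs <;> norm_num
      · exact hφ i k)
    (y := fun o => o.elim (projEq N (n : U) 1) y) (a := fun o => o.elim (mass T ι N n) a)
    (by
      rintro (_ | i) hi
      · exact hasExp_mass hT hι N n
      · exact hya i (Finset.some_mem_insertNone.1 hi))
    (by
      rintro (_ | i) hi k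
      · exact projEq_mul_projEq hT hι N n k
      · exact hy i (Finset.some_mem_insertNone.1 hi) k)
  simpa only [Finset.prod_insertNone, Option.elim] using h

section Moments

variable (hN : IsNatural T ι N) (hx : ∀ i, IsNatural T ι (x i))
  (hdist : ∀ i, SameTDist T ι (x i) (x 0))
  (hind : IsTIndependent T ι (fun o : Option ℕ => o.elim N x))
include hN hx hdist hind

theorem hasExp_randomSum {α a : U} (hα : HasExp T ι N α) (ha : HasExp T ι (x 0) a) :
    HasExp T ι (randomSum N x) (α * a) := by
  have hU := hι.isFAlgebra
  obtain ⟨-, hR0, hR⟩ := randomSum_spec hT hι hN hx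
  have hxa : ∀ i, HasExp T ι (x i) a := fun i =>
    hasExp_of_sameTDist hT hι (hx i) (hx 0) (hdist i) (fun k => Nat.cast_nonneg k)
      ((hx i).nonneg hT hι) (hU.projEq_natCast_mul _) (hU.projEq_natCast_mul _) ha
  have h1 : ∀ n i : ℕ, HasExp T ι (projEq N (n : U) 1 * x i) (mass T ι N n * a) := fun n i => by
    have := hind.hasExp_mul_prod hT hι hN hx n {i} (φ := fun _ k => k)
      (fun _ k => Nat.cast_nonneg k) (fun i _ => hxa i)
      fun i _ => hU.projEq_natCast_mul (x i)
    simpa only [Finset.prod_singleton] using this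
  refine (hN.hasExp_iff_sum hT hι hR0 (b := fun n => ((n : ℝ) • mass T ι N n) * a)
    fun n => ?_).2 ?_
  · have := HasExp.sum hT hι (Finset.range n) fun i _ => h1 n i
    rw [hR, Finset.mul_sum]
    convert this using 1
    rw [Finset.sum_const, Finset.card_range, ← Nat.cast_smul_eq_nsmul ℝ, smul_mul_assoc]
  · have h2 := (hN.hasExp_iff hT hι (fun k => Nat.cast_nonneg k) (hN.nonneg hT hι)
      (hU.projEq_natCast_mul N)).1 hα
    have h3 := hU.isLUB_mul h2 ha.nonneg_val
    simpa only [mul_comm a, Finset.sum_mul] using h3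

/-- On `N = n` the square of `S_n` has `n` diagonal terms with factor `b` and `n² - n` others with
factor `a²`. The second count leads to the positive element `N² - N`, of expectation `ν - α`. -/
theorem hasExp_randomSum_sq {α ν a b : U} (hα : HasExp T ι N α) (hν : HasExp T ι (N ^ 2) ν)
    (ha : HasExp T ι (x 0) a) (hb : HasExp T ι (x 0 ^ 2) b) :
    HasExp T ι (randomSum N x ^ 2) (α * b + (ν - α) * a ^ 2) := by
  have hU := hι.isFAlgebra
  obtain ⟨-, hR0, hR⟩ := randomSum_spec hT hι hN hx
  set R := randomSum N x
  have hxa : ∀ i, HasExp T ι (x i) a := fun i =>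
    hasExp_of_sameTDist hT hι (hx i) (hx 0) (hdist i) (fun k => Nat.cast_nonneg k)
      ((hx i).nonneg hT hι) (hU.projEq_natCast_mul _) (hU.projEq_natCast_mul _) ha
  have hxb : ∀ i, HasExp T ι (x i ^ 2) b := fun i =>
    hasExp_of_sameTDist hT hι (hx i) (hx 0) (hdist i) (fun k => sq_nonneg (k : ℝ))
      (pow_nonneg ((hx i).nonneg hT hι) 2) (projEq_natCast_mul_sq hT hι _)
      (projEq_natCast_mul_sq hT hι _) hb
  -- Writing the diagonal value `b` as `a² + (b - a²)` lets the double sum split into a constant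
  -- part and a diagonal part.
  have h1 : ∀ n i j : ℕ, HasExp T ι (projEq N (n : U) 1 * (x i * x j))
      (mass T ι N n * (a ^ 2 + if i = j then b - a ^ 2 else 0)) := fun n i j => by
    split_ifs with hij
    · have := hind.hasExp_mul_prod hT hι hN hx n {i} (φ := fun _ k => (k : ℝ) ^ 2)
        (fun _ k => sq_nonneg (k : ℝ)) (fun i _ => hxb i)
        fun i _ => projEq_natCast_mul_sq hT hι (x i)
      simpa only [Finset.prod_singleton, ← hij, add_sub_cancel, ← sq] using this
    · have := hind.hasExp_mul_prod hT hι hN hx n {i, j} (φ := fun _ k => k)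
        (fun _ k => Nat.cast_nonneg k) (fun i _ => hxa i)
        fun i _ => hU.projEq_natCast_mul (x i)
      simpa only [Finset.prod_pair hij, ← sq, add_zero] using this
  have hN1 : N ≤ N ^ 2 := hN.le_sq hT hι
  have hφ : ∀ n : ℕ, (0 : ℝ) ≤ (n : ℝ) ^ 2 - n := fun n =>
    sub_nonneg.2 (by exact_mod_cast Nat.le_self_pow two_ne_zero n)
  have hνα : HasExp T ι (N ^ 2 - N) (ν - α) := by
    obtain ⟨β, hβ⟩ := HasExp.exists_of_le (sub_nonneg.2 hN1) hν (sub_le_self _ hα.1)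
    have h2 := hβ.add hT hι hα
    rw [sub_add_cancel] at h2
    rwa [← h2.unique hν, add_sub_cancel_right]
  refine (hN.hasExp_iff_sum hT hι (pow_nonneg hR0 2) (b := fun n => b * ((n : ℝ) • mass T ι N n) +
    a ^ 2 * (((n : ℝ) ^ 2 - n) • mass T ι N n)) fun n => ?_).2 ?_
  · have h2 : projEq N (n : U) 1 * R ^ 2 =
        ∑ i ∈ Finset.range n, ∑ j ∈ Finset.range n, projEq N (n : U) 1 * (x i * x j) := by
      simp only [← Finset.mul_sum]
      rw [← Finset.sum_mul]
      linear_combination (R + ∑ i ∈ Finset.range n, x i) * hR n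
    have h3 := HasExp.sum hT hι (Finset.range n) fun i _ =>
      HasExp.sum hT hι (Finset.range n) fun j _ => h1 n i j
    rw [h2]
    convert h3 using 1
    simp only [← Finset.mul_sum, Finset.sum_add_distrib, Finset.sum_ite_eq, Finset.sum_const,
      Finset.card_range, Finset.sum_ite_mem, Finset.inter_self, nsmul_eq_mul, sub_smul]
    rw [sq (n : ℝ), mul_smul]
    simp only [Nat.cast_smul_eq_nsmul ℝ, nsmul_eq_mul]
    ring
  · have h2 := (hN.hasExp_iff hT hι (fun k => Nat.cast_nonneg k) (hN.nonneg hT hι)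
      (hU.projEq_natCast_mul N)).1 hα
    have h3 := (hN.hasExp_iff hT hι hφ (sub_nonneg.2 hN1) (fun k => by
      rw [mul_sub, hU.projEq_natCast_mul, projEq_natCast_mul_sq hT hι, ← sub_smul])).1 hνα
    have ha2 : 0 ≤ a ^ 2 := pow_nonneg ha.nonneg_val 2
    have h4 := hU.isLUB_mul h2 hb.nonneg_val
    have h5 := hU.isLUB_mul h3 ha2
    have h6 := isLUB_add_range h4 h5
      (fun _ _ h => mul_le_mul_of_nonneg_left (IsPartition.monotone_sum (fun k =>
        smul_nonneg (Nat.cast_nonneg k) (mass_nonneg hT hι N k)) h) hb.nonneg_val)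
      (fun _ _ h => mul_le_mul_of_nonneg_left (IsPartition.monotone_sum (fun k =>
        smul_nonneg (hφ k) (mass_nonneg hT hι N k)) h) ha2)
    rw [mul_comm b, mul_comm (a ^ 2)] at h6
    simpa only [Finset.mul_sum, ← Finset.sum_add_distrib] using h6

end Moments

theorem hasExp_of_inLp {u : U} (hu : 0 ≤ u) {p : ℕ} (h : InLp T ι p u) :
    HasExp T ι (u ^ p) (condExp T ι (u ^ p)) := by
  rw [InLp, abs_of_nonneg hu] at h
  exact hasExp_condExp hT hι (pow_nonneg hu p) h

omit hT hι in
theorem HasExp.inLp {u a : U} (hu : 0 ≤ u) {p : ℕ} (h : HasExp T ι (u ^ p) a) :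
    InLp T ι p u := by
  rw [InLp, abs_of_nonneg hu]
  exact h.inL1

end RandomSumMoments

/-! ### Finite elements below suprema in the sup-completion -/

section Cone

open Set

variable {U : Type*} [ConditionallyCompleteLattice U] [CommRing U] [IsOrderedRing U]

theorem SupCone.of_le_iff {v : U} (hv : 0 ≤ v) {B : SupCone U} : SupCone.of v ≤ B ↔ v ∈ B.1 := by
  constructor
  · exact fun h => h ⟨hv, le_sup_left⟩
  · rintro h w ⟨hw0, hw⟩
    exact B.2.2.2.1 v h w hw0 (by rwa [sup_eq_left.2 hv] at hw)

theorem SupCone.of_mono {u v : U} (h : u ≤ v) : SupCone.of u ≤ SupCone.of v :=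
  fun _ hw => ⟨hw.1, hw.2.trans (sup_le_sup_right h 0)⟩

theorem SupCone.mem_of_isLUB {B : SupCone U} {a : ℕ → U} {A : U} (h : IsLUB (range a) A)
    (ha : ∀ n, a n ∈ B.1) : A ∈ B.1 :=
  B.2.2.2.2 _ (by rintro _ ⟨n, rfl⟩; exact ha n) (range_nonempty a) A h

/-- A finite element below a monotone supremum in the cone is the supremum of its truncations. -/
theorem SupCone.isLUB_inf {a : ℕ → U} (ha : ∀ n, 0 ≤ a n) {u : U}
    (hu : u ∈ (⨆ n, SupCone.of (a n)).1) : IsLUB (range fun n => u ⊓ a n) u := by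
  -- The elements with the desired property form a member of the cone that contains every `a n`, so
  -- it dominates the supremum.
  set B : SupCone U := ⟨{v | 0 ≤ v ∧ IsLUB (range fun n => v ⊓ a n) v}, by
    refine ⟨⟨le_rfl, ?_⟩, fun v hv => hv.1, fun v hv w hw hwv => ⟨hw, ?_⟩,
      fun D hD hne b hb => ⟨?_, ?_⟩⟩
    · have : ∀ n, (0 : U) ⊓ a n = 0 := fun n => inf_eq_left.2 (ha n)
      simp only [this, range_const, isLUB_singleton]
    · have h1 := isLUB_inf_range hv.2 w
      simpa only [← inf_assoc, inf_eq_left.2 hwv] using h1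
    · obtain ⟨v, hv⟩ := hne
      exact (hD hv).1.trans (hb.1 hv)
    · refine ⟨by rintro _ ⟨n, rfl⟩; exact inf_le_left, fun w hw => hb.2 fun v hv => ?_⟩
      refine (hD hv).2.2 ?_
      rintro _ ⟨n, rfl⟩
      exact (inf_le_inf_right _ (hb.1 hv)).trans (hw ⟨n, rfl⟩)⟩
  have h1 : (⨆ n, SupCone.of (a n)) ≤ B := iSup_le fun n => (SupCone.of_le_iff (ha n)).2
    ⟨ha n, by rintro _ ⟨m, rfl⟩; exact inf_le_left, fun w hw => by simpa using hw ⟨n, rfl⟩⟩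
  exact (h1 hu).2

end Cone

/-! ### Generating functions through truncated powers -/

section GenFun

open Set

variable {E : Type*} [ConditionallyCompleteLattice E] [AddCommGroup E] [IsOrderedAddMonoid E]
  [Module ℝ E] [IsOrderedModule ℝ E]
variable {U : Type*} [ConditionallyCompleteLattice U] [CommRing U] [IsOrderedRing U]
  [Algebra ℝ U] [IsOrderedModule ℝ U]
variable {e : E} {T : E →ₗ[ℝ] E} {ι : E →ₗ[ℝ] U} {N : U} {x : ℕ → U}

theorem isLUB_sum_range {G κ : Type*} [Lattice G] [AddCommGroup G] [IsOrderedAddMonoid G]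
    (s : Finset κ) {a : κ → ℕ → G} {A : κ → G} (ha : ∀ i ∈ s, IsLUB (range (a i)) (A i))
    (ma : ∀ i ∈ s, Monotone (a i)) :
    IsLUB (range fun n => ∑ i ∈ s, a i n) (∑ i ∈ s, A i) ∧ Monotone fun n => ∑ i ∈ s, a i n := by
  classical
  induction s using Finset.induction_on with
  | empty => simpa using monotone_const
  | insert k s hk ih =>
    simp only [Finset.sum_insert hk]
    have ih' := ih (fun i hi => ha i (Finset.mem_insert_of_mem hi))
      fun i hi => ma i (Finset.mem_insert_of_mem hi)
    have hk' := Finset.mem_insert_self k s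
    exact ⟨isLUB_add_range (ha k hk') ih'.1 (ma k hk') ih'.2, (ma k hk').add ih'.2⟩

/-- The element `s ^ x` restricted to the component on which `x < M`. -/
noncomputable def truncPow (s : ℝ) (x : U) (M : ℕ) : U :=
  ∑ k ∈ Finset.range M, s ^ k • projEq x (k : U) 1

theorem IsFAlgebra.mul_truncPow (hU : IsFAlgebra U) {c y : U} (hc : 0 ≤ c) {j : ℕ}
    (h : c * y = (j : ℝ) • c) (s : ℝ) (M : ℕ) :
    c * truncPow s y M = (if j < M then s ^ j else 0) • c := by
  have h1 : ∀ k : ℕ, c * (s ^ k • projEq y (k : U) 1) =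
      if k = j then s ^ j • c else 0 := fun k => by
    rw [mul_smul_comm]
    split_ifs with hk
    · rw [hk, hU.mul_projEq_of_eq hc (h.trans (mul_natCast_eq_smul c j).symm)]
    · rw [hU.mul_projEq_of_ne hc h (mul_natCast_eq_smul c k)
        (Nat.cast_injective.ne (Ne.symm hk)), smul_zero]
  rw [truncPow, Finset.mul_sum, Finset.sum_congr rfl fun k _ => h1 k, Finset.sum_ite_eq']
  simp only [Finset.mem_range, ite_smul, zero_smul]

theorem IsFAlgebra.truncPow_nonneg (hU : IsFAlgebra U) {s : ℝ} (hs : 0 ≤ s) (y : U) (M : ℕ) :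
    0 ≤ truncPow s y M :=
  Finset.sum_nonneg fun k _ => smul_nonneg (pow_nonneg hs k) (hU.idem_nonneg (hU.projEq_idem _ _))

theorem IsFAlgebra.truncPow_mono (hU : IsFAlgebra U) {s : ℝ} (hs : 0 ≤ s) (y : U) :
    Monotone (truncPow s y) :=
  IsPartition.monotone_sum fun k => smul_nonneg (pow_nonneg hs k)
    (hU.idem_nonneg (hU.projEq_idem y k))

/-- A truncation of `s ^ S_N`. -/
noncomputable def truncSumPow (s : ℝ) (N : U) (x : ℕ → U) (M : ℕ) : U :=
  ∑ n ∈ Finset.range M, projEq N (n : U) 1 * ∏ i ∈ Finset.range n, truncPow s (x i) M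

variable (hT : IsConditionalRieszTriple e T) (hι : IsUniversalCompletion e ι)
include hT hι

theorem hasExp_truncPow {s : ℝ} (hs : 0 ≤ s) (y : U) (M : ℕ) :
    HasExp T ι (truncPow s y M) (∑ k ∈ Finset.range M, s ^ k • mass T ι y k) :=
  HasExp.sum hT hι _ fun k _ => (hasExp_mass hT hι y k).smul hT hι (pow_nonneg hs k)

theorem projEq_mul_truncPow (s : ℝ) (y : U) (M k : ℕ) :
    projEq y (k : U) 1 * truncPow s y M = (if k < M then s ^ k else 0) • projEq y (k : U) 1 :=
  hι.isFAlgebra.mul_truncPow (hι.isFAlgebra.idem_nonneg (hι.isFAlgebra.projEq_idem _ _))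
    (hι.isFAlgebra.projEq_natCast_mul y k) s M

theorem truncSumPow_mono {s : ℝ} (hs : 0 ≤ s) (N : U) (x : ℕ → U) :
    Monotone (truncSumPow s N x) := fun m n h => by
  have hU := hι.isFAlgebra
  have h0 : ∀ k : ℕ, 0 ≤ projEq N (k : U) 1 := fun k => hU.idem_nonneg (hU.projEq_idem _ _)
  refine (Finset.sum_le_sum fun k _ => mul_le_mul_of_nonneg_left
    (Finset.prod_le_prod (fun i _ => hU.truncPow_nonneg hs _ _)
      fun i _ => hU.truncPow_mono hs (x i) h) (h0 k)).trans ?_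
  exact Finset.sum_le_sum_of_subset_of_nonneg (Finset.range_subset_range.2 h) fun k _ _ =>
    mul_nonneg (h0 k) (Finset.prod_nonneg fun i _ => hU.truncPow_nonneg hs _ _)

theorem mul_truncSumPow (hN : IsNatural T ι N) (s : ℝ) (n M : ℕ) (k : ℕ → ℕ) :
    projEq N (n : U) 1 * (∏ i ∈ Finset.range n, projEq (x i) (k i : U) 1) *
      truncSumPow s N x M =
      (if n < M then ∏ i ∈ Finset.range n, (if k i < M then s ^ k i else 0) else 0) •
        (projEq N (n : U) 1 * ∏ i ∈ Finset.range n, projEq (x i) (k i : U) 1) := by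
  rw [mul_right_comm, truncSumPow, (hN.isPartition hT hι).mul_sum]
  split_ifs
  · rw [mul_assoc, ← Finset.prod_mul_distrib, ← mul_smul_comm, ← Finset.prod_smul]
    congr 1
    refine Finset.prod_congr rfl fun i _ => ?_
    rw [mul_comm, projEq_mul_truncPow hT hι]
  · rw [zero_mul, zero_smul]

/-- The left side is nonzero only where there are fewer than `M` summands, each below `M`; there
`S_N < M * M` and both sides agree. -/
theorem truncSumPow_le (hN : IsNatural T ι N) (hx : ∀ i, IsNatural T ι (x i)) {s : ℝ}
    (hs : 0 ≤ s) (M : ℕ) : truncSumPow s N x M ≤ truncPow s (randomSum N x) (M * M) := by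
  have hU := hι.isFAlgebra
  obtain ⟨-, -, hR⟩ := randomSum_spec hT hι hN hx
  refine le_of_local_randomSum hT hι hN hx fun n k => ?_
  have hc0 : 0 ≤ projEq N (n : U) 1 * ∏ i ∈ Finset.range n, projEq (x i) (k i : U) 1 :=
    prod_projEq_nonneg hT hι n k
  rw [mul_truncSumPow hT hι hN, hU.mul_truncPow hc0 (mul_randomSum_eq hT hι hR n k)]
  refine smul_le_smul_of_nonneg_right ?_ hc0
  have h0 : (0 : ℝ) ≤ if ∑ i ∈ Finset.range n, k i < M * M then
      s ^ ∑ i ∈ Finset.range n, k i else 0 := by split_ifs <;> positivity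
  by_cases hn : n < M
  · rw [if_pos hn]
    by_cases hk : ∀ i ∈ Finset.range n, k i < M
    · have h1 : ∑ i ∈ Finset.range n, k i < M * M := by
        calc ∑ i ∈ Finset.range n, k i ≤ (Finset.range n).card • M :=
              Finset.sum_le_card_nsmul _ _ _ fun i hi => (hk i hi).le
          _ = n * M := by simp
          _ < M * M := Nat.mul_lt_mul_of_pos_right hn (by omega)
      rw [if_pos h1, ← Finset.prod_pow_eq_pow_sum]
      exact (Finset.prod_congr rfl fun i hi => if_pos (hk i hi)).le
    · push Not at hk
      obtain ⟨i, hi, hki⟩ := hk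
      rw [Finset.prod_eq_zero hi (if_neg (not_lt.2 hki))]
      exact h0
  · rw [if_neg hn]
    exact h0

theorem isLUB_truncPow_inf (hN : IsNatural T ι N) (hx : ∀ i, IsNatural T ι (x i)) {s : ℝ}
    (hs : 0 ≤ s) (K : ℕ) :
    IsLUB (range fun M => truncPow s (randomSum N x) K ⊓ truncSumPow s N x M)
      (truncPow s (randomSum N x) K) := by
  have hU := hι.isFAlgebra
  obtain ⟨-, -, hR⟩ := randomSum_spec hT hι hN hx
  set Z := truncPow s (randomSum N x) K
  have hl := isLUB_ciSup (f := fun M => Z ⊓ truncSumPow s N x M)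
    ⟨Z, by rintro _ ⟨M, rfl⟩; exact inf_le_left⟩
  set A := ⨆ M, Z ⊓ truncSumPow s N x M
  have hA : A = Z := by
    refine le_antisymm (hl.2 (by rintro _ ⟨M, rfl⟩; exact inf_le_left)) ?_
    refine le_of_local_randomSum hT hι hN hx fun n k => ?_
    -- Once `M` exceeds `n` and all `k i`, the truncation has its full value `s ^ ∑ k i` on this
    -- component.
    obtain ⟨M, hnM, hkM⟩ : ∃ M, n < M ∧ ∀ i ∈ Finset.range n, k i < M :=
      ⟨n + (∑ i ∈ Finset.range n, k i) + 1, by omega, fun i hi => by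
        have := Finset.single_le_sum (fun _ _ => Nat.zero_le _) hi (f := k)
        omega⟩
    have h1 := mul_truncSumPow (x := x) hT hι hN s n M k
    have hc0 : 0 ≤ projEq N (n : U) 1 * ∏ i ∈ Finset.range n, projEq (x i) (k i : U) 1 :=
      prod_projEq_nonneg hT hι n k
    have h2 := hU.mul_truncPow hc0 (mul_randomSum_eq hT hι hR n k) s K
    rw [if_pos hnM, Finset.prod_congr rfl fun i hi => if_pos (hkM i hi),
      Finset.prod_pow_eq_pow_sum] at h1
    refine le_trans ?_ (mul_le_mul_of_nonneg_left (hl.1 ⟨M, rfl⟩) hc0)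
    dsimp only
    rw [hU.mul_inf hc0]
    refine le_inf le_rfl ?_
    rw [h1, h2]
    refine smul_le_smul_of_nonneg_right ?_ hc0
    split_ifs
    · exact le_rfl
    · exact pow_nonneg hs _
  rwa [hA] at hl

variable (hN : IsNatural T ι N) (hx : ∀ i, IsNatural T ι (x i))
  (hdist : ∀ i, SameTDist T ι (x i) (x 0))
  (hind : IsTIndependent T ι (fun o : Option ℕ => o.elim N x))
include hN hx hdist hind

theorem hasExp_truncSumPow {s : ℝ} (hs : 0 ≤ s) (M : ℕ) :
    HasExp T ι (truncSumPow s N x M) (∑ n ∈ Finset.range M,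
      mass T ι N n * (∑ k ∈ Finset.range M, s ^ k • mass T ι (x 0) k) ^ n) := by
  refine HasExp.sum hT hι _ fun n _ => ?_
  have h := hind.hasExp_mul_prod hT hι hN hx n (Finset.range n)
    (φ := fun _ k => if k < M then s ^ k else 0)
    (fun i k => by split_ifs <;> positivity)
    (y := fun i => truncPow s (x i) M)
    (a := fun _ => ∑ k ∈ Finset.range M, s ^ k • mass T ι (x 0) k)
    (fun i _ => by
      have := hasExp_truncPow hT hι hs (x i) M
      simpa only [mass_eq_of_sameTDist hT hι (hx i) (hx 0) (hdist i)] using this)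
    fun i _ k => projEq_mul_truncPow hT hι s (x i) M k
  simpa only [Finset.prod_const, Finset.card_range] using h

/-- The expectations of the two truncations of `s ^ S_N` have the same supremum in the cone.
Intersecting with a truncation of finite expectation allows monotone convergence although the limit
may be infinite. -/
theorem genFun_randomSum_eq_iSup {s : ℝ} (hs : 0 ≤ s) :
    genFun T ι (randomSum N x) s = ⨆ M : ℕ, SupCone.of (∑ n ∈ Finset.range M,
      mass T ι N n * (∑ k ∈ Finset.range M, s ^ k • mass T ι (x 0) k) ^ n) := by
  have hZ := hasExp_truncPow hT hι hs (randomSum N x)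
  have hA := hasExp_truncSumPow hT hι hN hx hdist hind hs
  refine le_antisymm (iSup_le fun K => ?_) (iSup_le fun M => ?_)
  · rw [SupCone.of_le_iff (hZ K).nonneg_val]
    have hex : ∀ M, ∃ b, HasExp T ι (truncPow s (randomSum N x) K ⊓ truncSumPow s N x M) b :=
      fun M => HasExp.exists_of_le (le_inf (hZ K).1 (hA M).1) (hZ K) inf_le_left
    choose b hb using hex
    have h1 := (hasExp_iff_of_monotone hT hι
      (fun m n h => inf_le_inf_left _ (truncSumPow_mono hT hι hs N x h)) hb
      (isLUB_truncPow_inf hT hι hN hx hs K)).1 (hZ K)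
    refine SupCone.mem_of_isLUB h1 fun M => (SupCone.of_le_iff (hb M).nonneg_val).1 ?_
    exact (SupCone.of_mono ((hb M).mono (hA M) inf_le_right)).trans (le_iSup (fun M : ℕ =>
      SupCone.of (∑ n ∈ Finset.range M,
        mass T ι N n * (∑ k ∈ Finset.range M, s ^ k • mass T ι (x 0) k) ^ n)) M)
  · exact (SupCone.of_mono ((hA M).mono (hZ (M * M)) (truncSumPow_le hT hι hN hx hs M))).trans
      (le_iSup (fun K : ℕ => SupCone.of (∑ k ∈ Finset.range K,
        s ^ k • mass T ι (randomSum N x) k)) (M * M))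

theorem genFun_randomSum {s : ℝ} (hs : 0 ≤ s) :
    genFun T ι (randomSum N x) s = genGenFunExt T ι N (genFun T ι (x 0) s) := by
  have hU := hι.isFAlgebra
  have hπ := fun n => mass_nonneg hT hι N n
  rw [genFun_randomSum_eq_iSup hT hι hN hx hdist hind hs]
  set G : ℕ → U := fun M => ∑ k ∈ Finset.range M, s ^ k • mass T ι (x 0) k
  have hGm : Monotone G := IsPartition.monotone_sum fun k =>
    smul_nonneg (pow_nonneg hs k) (mass_nonneg hT hι _ k)
  have hG0 : ∀ M, 0 ≤ G M := fun M => (hasExp_truncPow hT hι hs (x 0) M).nonneg_val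
  -- One direction takes `u = G M`. For the other, `u` is the supremum of `u ⊓ G M`, powers and
  -- finite sums respect it, and `max m M` bounds both the number of terms and the truncation level.
  refine le_antisymm (iSup_le fun M => ?_) (iSup₂_le fun u hu => iSup_le fun m => ?_)
  · have hmem : G M ∈ (genFun T ι (x 0) s).1 := (SupCone.of_le_iff (hG0 M)).1
      (le_iSup (fun M => SupCone.of (G M)) M)
    exact (le_iSup (fun m : ℕ => SupCone.of (∑ n ∈ Finset.range m,
      mass T ι N n * G M ^ n)) M).trans (le_iSup₂ (f := fun u (_ : u ∈ (genFun T ι (x 0) s).1) =>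
        genGenFun T ι N u) (G M) hmem)
  · have hu0 : 0 ≤ u := (genFun T ι (x 0) s).2.2.1 u hu
    have h0 : ∀ M, 0 ≤ u ⊓ G M := fun M => le_inf hu0 (hG0 M)
    have hm : Monotone fun M => u ⊓ G M := fun i j h => inf_le_inf_left _ (hGm h)
    have hl : IsLUB (range fun M => u ⊓ G M) u := SupCone.isLUB_inf hG0 hu
    have h1 := isLUB_sum_range (Finset.range m)
      (a := fun n M => mass T ι N n * (u ⊓ G M) ^ n) (A := fun n => mass T ι N n * u ^ n)
      (fun n _ => hU.isLUB_mul (hU.isLUB_pow_range hl hm h0 n) (hπ n))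
      fun n _ i j h => mul_le_mul_of_nonneg_left (pow_le_pow_left₀ (h0 i) (hm h) n) (hπ n)
    rw [SupCone.of_le_iff (Finset.sum_nonneg fun n _ => mul_nonneg (hπ n) (pow_nonneg hu0 n))]
    refine SupCone.mem_of_isLUB h1.1 fun M => (SupCone.of_le_iff
      (Finset.sum_nonneg fun n _ => mul_nonneg (hπ n) (pow_nonneg (h0 M) n))).1 ?_
    refine le_trans (SupCone.of_mono ?_) (le_iSup (fun M : ℕ => SupCone.of
      (∑ n ∈ Finset.range M, mass T ι N n * G M ^ n)) (max m M))
    refine (Finset.sum_le_sum fun n _ => mul_le_mul_of_nonneg_left (pow_le_pow_left₀ (h0 M)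
      (inf_le_right.trans (hGm (le_max_right m M))) n) (hπ n)).trans ?_
    exact Finset.sum_le_sum_of_subset_of_nonneg
      (Finset.range_subset_range.2 (le_max_left m M)) fun n _ _ =>
        mul_nonneg (hπ n) (pow_nonneg (hG0 _) n)

omit hN hx hdist hind in
theorem genGenFunExt_of {N u : U} (hu : 0 ≤ u) :
    genGenFunExt T ι N (SupCone.of u) = genGenFun T ι N u := by
  refine le_antisymm (iSup₂_le fun v hv => iSup_le fun m => ?_) ?_
  · have hvu : v ≤ u := hv.2.trans (sup_le le_rfl hu)
    refine le_trans (SupCone.of_mono ?_) (le_iSup (fun m : ℕ => SupCone.of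
      (∑ n ∈ Finset.range m, mass T ι N n * u ^ n)) m)
    exact Finset.sum_le_sum fun n _ =>
      mul_le_mul_of_nonneg_left (pow_le_pow_left₀ hv.1 hvu n) (mass_nonneg hT hι N n)
  · exact le_iSup₂ (f := fun v (_ : v ∈ (SupCone.of u).1) => genGenFun T ι N v) u
      ⟨hu, le_sup_left⟩

end GenFun
end RieszGF

/-! ### The theorem -/

open RieszGF in
theorem mainTheorem6
    {E : Type*} [ConditionallyCompleteLattice E] [AddCommGroup E] [IsOrderedAddMonoid E]
    [Module ℝ E] [IsOrderedModule ℝ E]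
    {U : Type*} [ConditionallyCompleteLattice U] [CommRing U] [IsOrderedRing U]
    [Algebra ℝ U] [IsOrderedModule ℝ U]
    (e : E) (T : E →ₗ[ℝ] E) (hT : IsConditionalRieszTriple e T)
    (ι : E →ₗ[ℝ] U) (hι : IsUniversalCompletion e ι)
    (N : U) (x : ℕ → U) (hN : IsNatural T ι N) (hx : ∀ i, IsNatural T ι (x i))
    (hdist : ∀ i, SameTDist T ι (x i) (x 0))
    (hind : IsTIndependent T ι (fun o : Option ℕ => o.elim N x)) :
    -- the series defining the random sum converges, and the random sum is natural
    (IsLUB (Set.range (randomSumPartial N x)) (randomSum N x) ∧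
      IsNatural T ι (randomSum N x)) ∧
    -- (i) the generating function, also at arguments where it is infinite
    (∀ s : ℝ, 0 ≤ s →
      genFun T ι (randomSum N x) s = genGenFunExt T ι N (genFun T ι (x 0) s)) ∧
    (∀ s : ℝ, 0 ≤ s → ∀ u : U, 0 ≤ u → genFun T ι (x 0) s = SupCone.of u →
      genFun T ι (randomSum N x) s = genGenFun T ι N u) ∧
    -- (ii) the conditional mean
    (InLp T ι 1 N → InLp T ι 1 (x 0) →
      InLp T ι 1 (randomSum N x) ∧
      condExp T ι (randomSum N x) = condExp T ι N * condExp T ι (x 0)) ∧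
    -- (iii) the conditional variance
    (InLp T ι 2 N → InLp T ι 2 (x 0) →
      InLp T ι 2 (randomSum N x) ∧
      condVar T ι (randomSum N x) =
        condExp T ι N * condVar T ι (x 0) + condVar T ι N * condExp T ι (x 0) ^ 2) ∧
    -- the two expressions for the conditional variance agree
    (∀ y : U, InLp T ι 2 y → condVar T ι y = condExp T ι (y ^ 2) - condExp T ι y ^ 2) := by
  have hspec := randomSum_spec hT hι hN hx
  have hR := isNatural_randomSum hT hι hN hx
  have hx0 := (hx 0).nonneg hT hι
  have hN0 := hN.nonneg hT hι
  refine ⟨⟨hspec.1, hR⟩, fun s hs => genFun_randomSum hT hι hN hx hdist hind hs,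
    fun s hs u hu h => ?_, fun hN1 hx1 => ?_, fun hN2 hx2 => ?_, fun y hy => condVar_eq hT hι hy⟩
  · rw [genFun_randomSum hT hι hN hx hdist hind hs, h, genGenFunExt_of hT hι hu]
  · have h1 := hasExp_of_inLp hT hι hN0 hN1
    have h2 := hasExp_of_inLp hT hι hx0 hx1
    rw [pow_one] at h1 h2
    have h3 := hasExp_randomSum hT hι hN hx hdist hind h1 h2
    exact ⟨HasExp.inLp hspec.2.1 (by rwa [pow_one]), h3.condExp_eq hT hι⟩
  · have hν := hasExp_of_inLp hT hι hN0 hN2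
    have hb := hasExp_of_inLp hT hι hx0 hx2
    -- Natural elements satisfy `y ≤ y²`, so finite second moments give finite means.
    obtain ⟨α, hα⟩ := HasExp.exists_of_le hN0 hν (hN.le_sq hT hι)
    obtain ⟨a, ha⟩ := HasExp.exists_of_le hx0 hb ((hx 0).le_sq hT hι)
    have h1 := hasExp_randomSum hT hι hN hx hdist hind hα ha
    have h2 := hasExp_randomSum_sq hT hι hN hx hdist hind hα hν ha hb
    have hR2 : InLp T ι 2 (randomSum N x) := HasExp.inLp hspec.2.1 h2
    refine ⟨hR2, ?_⟩
    rw [condVar_eq hT hι hR2, condVar_eq hT hι hN2, condVar_eq hT hι hx2, h1.condExp_eq hT hι,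
      h2.condExp_eq hT hι, hα.condExp_eq hT hι, ha.condExp_eq hT hι]
    ring
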